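/- All graphs are finite and simple. Let $G$ be a triangle-free graph. For an integer $k\ge 0$, a $k$-edge-colouring of $G$ is a map $\alpha:E(G)\to\{1,\dots,k\}$ such that $\alpha(e)\neq\alpha(f)$ whenever $e\ne f$ share an endpoint, and the chromatic index $\chi'(G)$ is the least $k$ for which $G$ has a $k$-edge-colouring. A Kempe change of a $k$-edge-colouring consists in choosing two distinct colours $a,b\in\{1,\dots,k\}$ and a connected component of the subgraph formed by the edges coloured $a$ or $b$, and exchanging the colours $a$ and $b$ on the edges of that component. **Theorem 1.5.** Let $G$ be a finite simple triangle-free graph, let $k>\chi'(G)$ be an integer, let $\alpha$ be a $k$-edge-colouring of $G$, and let $\gamma$ be a $k$-edge-colouring of $G$ that uses at most $\chi'(G)$ of the $k$ colours (for example, any $\chi'(G)$-edge-colouring $\gamma:E(G)\to\{1,\dots,\chi'(G)\}$). Then $\gamma$ can be obtained from $\alpha$ by a finite (possibly empty) sequence of Kempe changes, all intermediate colourings being $k$-edge-colourings of $G$. -/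

import Mathlib

namespace SimpleGraph

variable {V : Type*} {K : Type*} {G : SimpleGraph V}

/-- A proper edge-colouring of `G` with colours in `K`: distinct edges that share an endpoint get
distinct colours. -/
abbrev EdgeColoring (G : SimpleGraph V) (K : Type*) : Type _ := G.lineGraph.Coloring K

/-- The chromatic index of `G`: the least `n` such that `G` has a proper edge-colouring with `n`
colours (and `⊤` if there is no such `n`, which does not happen for a finite graph). -/
noncomputable def chromaticIndex (G : SimpleGraph V) : ℕ∞ := G.lineGraph.chromaticNumber

namespace EdgeColoring

/-- The spanning subgraph of `G` formed by the edges coloured `a` or `b`. -/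
def bicoloured (α : G.EdgeColoring K) (a b : K) : SimpleGraph V :=
  fromEdgeSet {e | ∃ h : e ∈ G.edgeSet, α ⟨e, h⟩ = a ∨ α ⟨e, h⟩ = b}

theorem bicoloured_adj (α : G.EdgeColoring K) (a b : K) (v w : V) :
    (α.bicoloured a b).Adj v w ↔
      ∃ h : G.Adj v w, α ⟨s(v, w), h⟩ = a ∨ α ⟨s(v, w), h⟩ = b := by
  unfold bicoloured
  rw [fromEdgeSet_adj]
  constructor
  · rintro ⟨⟨h, hc⟩, -⟩
    exact ⟨h, hc⟩
  · rintro ⟨h, hc⟩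
    exact ⟨⟨h, hc⟩, h.ne⟩

/-- An edge coloured `a` or `b` that has one endpoint in a component of the bicoloured subgraph
has all its endpoints in it. -/
theorem mem_supp_of_mem (α : G.EdgeColoring K) {a b : K}
    (C : (α.bicoloured a b).ConnectedComponent) (e : G.edgeSet) (he : α e = a ∨ α e = b)
    {v w : V} (hv : v ∈ (e : Sym2 V)) (hw : w ∈ (e : Sym2 V)) (hvC : v ∈ C.supp) :
    w ∈ C.supp := by
  by_cases hvw : v = w
  · exact hvw ▸ hvC
  · obtain ⟨e, hG⟩ := e
    obtain rfl : e = s(v, w) := (Sym2.mem_and_mem_iff hvw).1 ⟨hv, hw⟩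
    have hadj : (α.bicoloured a b).Adj v w := (α.bicoloured_adj a b v w).2 ⟨hG, he⟩
    rw [ConnectedComponent.mem_supp_iff] at hvC ⊢
    rw [← hvC]
    exact ConnectedComponent.sound hadj.symm.reachable

open Classical in
/-- The colouring obtained from `α` by exchanging the colours `a` and `b` on the edges of the
component `C` of the subgraph of edges coloured `a` or `b`. (Edges with another colour are fixed
by `Equiv.swap a b`, and an edge coloured `a` or `b` that meets `C` belongs to `C`. If `C` has no
edge, then nothing changes.) -/
noncomputable def kempeSwap (α : G.EdgeColoring K) (a b : K)
    (C : (α.bicoloured a b).ConnectedComponent) : G.EdgeColoring K :=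
  Coloring.mk
    (fun e => if ∃ v ∈ C.supp, v ∈ (e : Sym2 V) then Equiv.swap a b (α e) else α e) <| by
    intro e f hef
    have hne : α e ≠ α f := α.valid hef
    obtain ⟨-, x, hxe, hxf⟩ := lineGraph_adj_iff_exists.1 hef
    have key : ∀ g : G.edgeSet, x ∈ (g : Sym2 V) → x ∉ C.supp →
        (∃ v ∈ C.supp, v ∈ (g : Sym2 V)) → Equiv.swap a b (α g) = α g := by
      rintro g hxg hxC ⟨v, hvC, hvg⟩
      have hg : ¬ (α g = a ∨ α g = b) := fun hg => hxC (α.mem_supp_of_mem C g hg hvg hxg hvC)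
      exact Equiv.swap_apply_of_ne_of_ne (fun h => hg (Or.inl h)) (fun h => hg (Or.inr h))
    by_cases hxC : x ∈ C.supp
    · rw [if_pos ⟨x, hxC, hxe⟩, if_pos ⟨x, hxC, hxf⟩]
      exact (Equiv.swap a b).injective.ne hne
    · have h1 : ∀ g : G.edgeSet, x ∈ (g : Sym2 V) →
          (if ∃ v ∈ C.supp, v ∈ (g : Sym2 V) then Equiv.swap a b (α g) else α g) = α g := by
        intro g hxg
        split_ifs with h
        · exact key g hxg hxC h
        · rfl
      rw [h1 e hxe, h1 f hxf]
      exact hne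

/-- `β` arises from `α` by one Kempe change: for two distinct colours `a`, `b`, the two colours
are exchanged on one connected component of the subgraph of edges coloured `a` or `b`. -/
def KempeChange (α β : G.EdgeColoring K) : Prop :=
  ∃ a b : K, a ≠ b ∧ ∃ C : (α.bicoloured a b).ConnectedComponent, β = α.kempeSwap a b C

/-- `β` can be reached from `α` by a finite (possibly empty) sequence of Kempe changes, all
intermediate colourings having their colours in `K`. -/
def KempeReachable (α β : G.EdgeColoring K) : Prop := Relation.ReflTransGen KempeChange α β

end EdgeColoring

end SimpleGraph

/-! Some colour `o` is absent from `γ`. The graph is embedded in a finite triangle-free graph on `V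
× (K → Bool)` in which every vertex misses exactly one colour, recorded as the colour of a loop: the
copies of a vertex missing `c ≠ o` are matched along direction `c` of a cube. There `γ` extends with
every loop coloured `o`, and `α` extends over the same edges, because at each vertex of `G` a
permutation of the colours carries `γ` to `α` and cube edges join copies of one vertex. Swaps
upstairs restrict to sequences of Kempe changes on `G` (`exists_kempeReachable_of_reach`), so the
work is done upstairs.

There every colour class of the target other than `o` is a perfect matching. Once it is
monochromatic in the current colouring (`exists_reach_matching`), it is deleted together with its
colour, and induction on the number of colours applies (`reach_of_loops_eq`). To give an edge `vw`
the colour `c`, one makes `c` missing at `v`, then at `w`, and recolours the single edge. Making `c`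
missing at `v` means shifting the Vizing fan that starts with the edge `uv` of colour `c`. A fan
reaching its centre is shifted edge by edge; a fan with two vertices missing the same colour is
brought to that form by a swap; the hard case is a cyclic fan.

The core is thus `IsBalanced.reach_rot`, by induction on the size of the fan. For `y` in a cyclic
fan `S` at `u`, consider the fan at `y` starting at `u`. A two-coloured component has at most two
loops (`not_conn_or`), so the connections that would obstruct the various moves cannot all be
present. Either `S` is inverted directly or through a smaller fan, or a fan `Z` at `y` is moved
first, which opens `S` into a path that can be shifted, and `Z` is then put back. Triangle-freeness
makes `S` and `Z` disjoint, so these moves interact only through the edge `uy` and its two ends. -/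

namespace LoopedColoring

/-! ### Colourings with loops, closed sets and swaps -/

variable {V K : Type*} {R : V → V → Prop} {φ ψ χ : V → V → K} {a b c d : K} {u v w x y z s : V}
  {S T Z C D : Set V}

/-- A proper edge-colouring of a reflexive graph `R` in which every colour occurs at every vertex:
the colour of the loop at `v` is the only colour that is missing at `v` in the underlying simple
graph. Values of `φ` off `R` are irrelevant. -/
structure IsColoring (R : V → V → Prop) (φ : V → V → K) : Prop where
  refl : ∀ v, R v v
  rel_symm : ∀ {v w}, R v w → R w v
  symm : ∀ {v w}, R v w → φ v w = φ w v
  inj : ∀ {v w w'}, R v w → R v w' → φ v w = φ v w' → w = w'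
  surj : ∀ v c, ∃ w, R v w ∧ φ v w = c

/-- `C` is a union of components of the subgraph of edges coloured `a` or `b`. -/
def Closed (R : V → V → Prop) (φ : V → V → K) (a b : K) (C : Set V) : Prop :=
  ∀ ⦃v w⦄, R v w → φ v w = a ∨ φ v w = b → v ∈ C → w ∈ C

open Classical in
/-- Exchange the colours `a` and `b` at the vertices of `C`. -/
noncomputable def swapOn (φ : V → V → K) (a b : K) (C : Set V) (v w : V) : K :=
  if v ∈ C then (if φ v w = a then b else if φ v w = b then a else φ v w) else φ v w

/-- The colouring `ψ` agrees on `R` with a swap of `φ` on a closed set. -/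
def Step (R : V → V → Prop) (φ ψ : V → V → K) : Prop :=
  ∃ a b C, Closed R φ a b C ∧ ∀ v w, R v w → ψ v w = swapOn φ a b C v w

/-- Reachability by swaps on closed sets. -/
def Reach (R : V → V → Prop) : (V → V → K) → (V → V → K) → Prop :=
  Relation.ReflTransGen (Step R)

open Classical in
/-- Exchange the colours of the edge `uy` and the loop at `y` for all `y ∈ S`, and give the loop
at `u` the colour `d`. -/
noncomputable def rot (φ : V → V → K) (u : V) (S : Set V) (d : K) (v w : V) : K :=
  if v = u then (if w = u then d else if w ∈ S then φ w w else φ u w)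
  else if v ∈ S then (if w = u then φ v v else if w = v then φ u v else φ v w) else φ v w

theorem rot_cases (φ : V → V → K) (d : K) (hS : ∀ y ∈ S, y ≠ u) (v w : V) :
    v = u ∧ w = u ∧ rot φ u S d v w = d ∨
    v = u ∧ w ∈ S ∧ w ≠ u ∧ rot φ u S d v w = φ w w ∨
    w = u ∧ v ∈ S ∧ v ≠ u ∧ rot φ u S d v w = φ v v ∨
    v = w ∧ v ∈ S ∧ v ≠ u ∧ rot φ u S d v w = φ u v ∨
    (¬ (v = u ∧ w = u) ∧ ¬ (v = u ∧ w ∈ S) ∧ ¬ (w = u ∧ v ∈ S) ∧ ¬ (v = w ∧ v ∈ S)) ∧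
      rot φ u S d v w = φ v w := by
  have h1 := hS v
  have h2 := hS w
  by_cases hv : v = u
  · subst hv
    by_cases hw : w = v
    · simp [rot, hw]
    · by_cases hwS : w ∈ S <;> simp [rot, hw, hwS, Ne.symm hw]
  · by_cases hvS : v ∈ S
    · by_cases hw : w = u
      · simp [rot, hv, hvS, hw]
      · by_cases hwv : w = v
        · simp [rot, hv, hvS, hwv]
        · simp [rot, hv, hvS, hw, hwv, Ne.symm hwv]
    · simp [rot, hv, hvS]

theorem rot_self : rot φ u S d u u = d := by simp [rot]

theorem rot_spoke (hw : w ∈ S) (h : w ≠ u) : rot φ u S d u w = φ w w := by simp [rot, hw, h]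

theorem rot_loop (hw : w ∈ S) (h : w ≠ u) : rot φ u S d w w = φ u w := by simp [rot, hw, h]

theorem rot_spoke_of_notMem (hw : w ∉ S) (h : w ≠ u) : rot φ u S d u w = φ u w := by
  simp [rot, hw, h]

theorem rot_of_notMem (hv : v ∉ S) (h : v ≠ u) : rot φ u S d v w = φ v w := by
  simp [rot, hv, h]

theorem rot_of_ne (hv : v ≠ u) (hw : w ≠ u) (h : v ≠ w) : rot φ u S d v w = φ v w := by
  simp [rot, hv, hw, h.symm]

theorem Closed.compl (hφ : IsColoring R φ) (h : Closed R φ a b C) : Closed R φ a b Cᶜ := by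
  intro v w hvw hc hv hw
  exact hv (h (hφ.rel_symm hvw) (by rwa [← hφ.symm hvw]) hw)

theorem Closed.comm (h : Closed R φ a b C) : Closed R φ b a C := by
  intro v w hvw hc hv
  exact h hvw hc.symm hv

theorem IsColoring.swapOn (hφ : IsColoring R φ) (h : Closed R φ a b C) :
    IsColoring R (swapOn φ a b C) where
  refl := hφ.refl
  rel_symm := hφ.rel_symm
  symm {v w} hvw := by
    have h1 := @h v w hvw
    have h2 := @h w v (hφ.rel_symm hvw)
    have h3 := hφ.symm hvw
    unfold LoopedColoring.swapOn
    grind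
  inj {v w w'} hw hw' he := by
    have := hφ.inj hw hw'
    unfold LoopedColoring.swapOn at he
    grind
  surj v c := by
    obtain ⟨x, hx, hxc⟩ := hφ.surj v c
    obtain ⟨y, hy, hya⟩ := hφ.surj v a
    obtain ⟨z, hz, hzb⟩ := hφ.surj v b
    unfold LoopedColoring.swapOn
    grind

theorem IsColoring.congr (hφ : IsColoring R φ) (h : ∀ v w, R v w → ψ v w = φ v w) :
    IsColoring R ψ where
  refl := hφ.refl
  rel_symm := hφ.rel_symm
  symm {v w} hvw := by
    rw [h v w hvw, h w v (hφ.rel_symm hvw), hφ.symm hvw]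
  inj {v w w'} hw hw' he := hφ.inj hw hw' (by rwa [h _ _ hw, h _ _ hw'] at he)
  surj v c := by
    obtain ⟨x, hx, hxc⟩ := hφ.surj v c
    exact ⟨x, hx, by rw [h _ _ hx, hxc]⟩

theorem IsColoring.step (hφ : IsColoring R φ) (h : Step R φ ψ) : IsColoring R ψ := by
  obtain ⟨a, b, C, hC, hψ⟩ := h
  exact (hφ.swapOn hC).congr hψ

theorem IsColoring.reach (hφ : IsColoring R φ) (h : Reach R φ ψ) : IsColoring R ψ := by
  induction h with
  | refl => exact hφ
  | tail _ h ih => exact ih.step h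

theorem Reach.trans (h : Reach R φ ψ) (h' : Reach R ψ χ) : Reach R φ χ :=
  Relation.ReflTransGen.trans h h'

theorem Closed.reach (h : Closed R φ a b C) (hψ : ∀ v w, R v w → ψ v w = swapOn φ a b C v w) :
    Reach R φ ψ :=
  .single ⟨a, b, C, h, hψ⟩

theorem reach_of_agree [Nonempty K] (h : ∀ v w, R v w → ψ v w = φ v w) : Reach R φ ψ :=
  .single ⟨Classical.arbitrary K, Classical.arbitrary K, ∅, fun _ _ _ _ h => h.elim,
    fun v w hvw => by
    simpa [swapOn] using h v w hvw⟩

theorem Reach.congr (h : Reach R φ ψ) (hχ : ∀ v w, R v w → χ v w = ψ v w) : Reach R φ χ := by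
  rcases isEmpty_or_nonempty K with hK | hK
  · have : χ = ψ := by
      funext v w
      exact hK.elim (χ v w)
    exact this ▸ h
  · exact h.trans (reach_of_agree hχ)

/-- Every `(a, b)`-closed set that contains `x` contains `y`. -/
def Conn (R : V → V → Prop) (φ : V → V → K) (a b : K) (x y : V) : Prop :=
  ∀ C, Closed R φ a b C → x ∈ C → y ∈ C

theorem Conn.symm (hφ : IsColoring R φ) (h : Conn R φ a b x y) : Conn R φ a b y x := by
  intro C hC hy
  by_contra hx
  exact h _ (hC.compl hφ) hx hy

theorem exists_closed_of_not_conn (hφ : IsColoring R φ) (h : ¬ Conn R φ a b x y) :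
    ∃ C, Closed R φ a b C ∧ x ∉ C ∧ y ∈ C := by
  unfold Conn at h
  push Not at h
  obtain ⟨C, hC, hx, hy⟩ := h
  exact ⟨Cᶜ, hC.compl hφ, fun h => h hx, hy⟩

/-! ### Shifting a fan that ends at its centre -/

/-- The fan at `u` along `S` can be shifted: the loop colours of `S` are distinct, each of them is
the colour of the loop at `u` or of an edge from `u` to `S`, and following the fan one leaves `S`.
The colour `d` is the one that becomes free at `u`. -/
structure IsPath (R : V → V → Prop) (φ : V → V → K) (u : V) (S : Set V) (d : K) : Prop where
  rel : ∀ y ∈ S, R u y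
  ne : ∀ y ∈ S, y ≠ u
  inj : ∀ y ∈ S, ∀ z ∈ S, φ y y = φ z z → y = z
  next : ∀ y ∈ S, φ y y = φ u u ∨ ∃ z ∈ S, φ u z = φ y y
  wf : ∀ T ⊆ S, (∀ y ∈ T, ∃ z ∈ T, φ u z = φ y y) → T = ∅
  last : d = φ u u ∨ ∃ z ∈ S, φ u z = d
  last_ne : ∀ y ∈ S, φ y y ≠ d

/-- The fan is shifted from its last vertex backwards: each move is a swap on a component consisting
of one edge and the loops at its two ends, and it turns the preceding vertex into the last one. -/
theorem IsPath.reach [Finite V] (hφ : IsColoring R φ) (h : IsPath R φ u S d) :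
    Reach R φ (rot φ u S d) := by
  induction hn : S.ncard generalizing φ S with
  | zero =>
    obtain rfl : S = ∅ := (Set.ncard_eq_zero).1 hn
    have : Nonempty K := ⟨d⟩
    refine reach_of_agree fun v w hvw => ?_
    have := h.last
    unfold rot
    grind
  | succ n ih =>
    -- This is the last vertex of the fan; without it `S` itself would contradict `wf`.
    obtain ⟨y, hy, hyu⟩ : ∃ y ∈ S, φ y y = φ u u := by
      by_contra! hcon
      have := h.wf S subset_rfl fun y hy => (h.next y hy).resolve_left (hcon y hy)
      simp [this] at hn
    have hyne := h.ne y hy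
    have hRy := h.rel y hy
    have huy := hφ.symm hRy
    have hinj := @hφ.inj
    have huu := hφ.refl u
    have hyy := hφ.refl y
    have hyu' := hφ.rel_symm hRy
    set ψ := swapOn φ (φ u u) (φ u y) {u, y} with hψ
    -- Both ends of `uy` carry loops of colour `φ u u`, so nothing else is attached to this edge.
    have hcl : Closed R φ (φ u u) (φ u y) {u, y} := by
      intro v w hvw hc hv
      simp only [Set.mem_insert_iff, Set.mem_singleton_iff] at hv ⊢
      grind
    have h1 : Reach R φ ψ := hcl.reach fun _ _ _ => rfl
    have hψc := hφ.reach h1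
    have e1 : ψ u u = φ u y := by simp [hψ, swapOn]
    have e2 : ∀ z ∈ S \ {y}, ψ z z = φ z z := by
      intro z hz
      have := h.ne z hz.1
      have : z ≠ y := hz.2
      simp [swapOn, *]
    have e3 : ∀ z ∈ S \ {y}, ψ u z = φ u z := by
      intro z hz
      have h1 := h.ne z hz.1
      have h2 : z ≠ y := hz.2
      have h3 := hφ.inj (h.rel z hz.1) huu
      have h4 := hφ.inj (h.rel z hz.1) hRy
      simp only [hψ, swapOn]
      grind
    have hpath : IsPath R ψ u (S \ {y}) d := by
      refine ⟨fun z hz => h.rel z hz.1, fun z hz => h.ne z hz.1, ?_, ?_, ?_, ?_, ?_⟩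
      · intro z hz w hw he
        rw [e2 z hz, e2 w hw] at he
        exact h.inj z hz.1 w hw.1 he
      · intro z hz
        rw [e2 z hz, e1]
        have hz2 : z ≠ y := hz.2
        rcases h.next z hz.1 with h1 | ⟨w, hw, hwz⟩
        · exact absurd (h.inj z hz.1 y hy (h1.trans hyu.symm)) hz2
        · by_cases hwy : w = y
          · left; rw [← hwz, hwy]
          · exact .inr ⟨w, ⟨hw, hwy⟩, by rw [e3 w ⟨hw, hwy⟩, hwz]⟩
      · intro T hT hTc
        refine h.wf T (hT.trans Set.sdiff_subset) fun z hz => ?_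
        obtain ⟨w, hw, hwz⟩ := hTc z hz
        exact ⟨w, hw, by rw [← e3 w (hT hw), hwz, e2 z (hT hz)]⟩
      · rw [e1]
        rcases h.last with h1 | ⟨z, hz, hzd⟩
        · exact absurd (hyu.trans h1.symm) (h.last_ne y hy)
        · by_cases hzy : z = y
          · left; rw [← hzd, hzy]
          · exact .inr ⟨z, ⟨hz, hzy⟩, by rw [e3 z ⟨hz, hzy⟩, hzd]⟩
      · intro z hz
        rw [e2 z hz]
        exact h.last_ne z hz.1
    have hcard : (S \ {y}).ncard = n := by
      rw [Set.ncard_sdiff_singleton_of_mem hy, hn]; rfl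
    refine (h1.trans (ih hψc hpath hcard)).congr fun v w hvw => ?_
    have e4 := hψc.symm hvw
    have e5 := @h.ne
    have e6 := @h.rel
    have e7 := hφ.symm hvw
    have e8 := hφ.rel_symm hvw
    unfold rot
    have mem : ∀ z, z ∈ S \ {y} ↔ z ∈ S ∧ z ≠ y := by simp
    simp only [mem, hψ, swapOn, Set.mem_insert_iff, Set.mem_singleton_iff] at e4 ⊢
    grind

/-! ### Loops in a two-coloured component -/

/-- If `n` divides some `2 * l - 1`, then 2 is invertible modulo `n`; otherwise the parities of the
two quotients decide. -/
theorem Int.dvd_or_of_dvd_two_mul {n k l : ℤ} (hk : n ∣ 2 * k ∨ n ∣ 2 * k - 1)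
    (hl : n ∣ 2 * l ∨ n ∣ 2 * l - 1) : n ∣ k ∨ n ∣ l ∨ n ∣ k - l := by
  rcases hk with hk | hk <;> rcases hl with hl | hl
  · obtain ⟨s, hs⟩ := hk
    obtain ⟨t, ht⟩ := hl
    rcases Int.even_or_odd' s with ⟨s', rfl | rfl⟩
    · exact .inl ⟨s', by linarith⟩
    · rcases Int.even_or_odd' t with ⟨t', rfl | rfl⟩
      · exact .inr (.inl ⟨t', by linarith⟩)
      · exact .inr (.inr ⟨s' - t', by linarith⟩)
  · left
    have : k = 2 * k * l - (2 * l - 1) * k := by ring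
    rw [this]
    exact dvd_sub (hk.mul_right _) (hl.mul_right _)
  · right; left
    have : l = 2 * l * k - (2 * k - 1) * l := by ring
    rw [this]
    exact dvd_sub (hl.mul_right _) (hk.mul_right _)
  · right; right
    have : k - l = ((2 * k - 1) - (2 * l - 1)) * l - (2 * l - 1) * (k - l) := by ring
    rw [this]
    exact dvd_sub ((dvd_sub hk hl).mul_right _) (hl.mul_right _)

/-- The maps to the `a`-neighbour and to the `b`-neighbour are involutions `p` and `q`, whose fixed
points are the loops. Since `p` fixes `x`, the orbit of `x` under `σ = q * p` is already closed. On
it `p` and `q` act by `k ↦ -k` and `k ↦ 1 - k`, so the loops correspond to solutions of `2 * k = 0`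
or `2 * k = 1` modulo the period, and `k = 0` leaves room for at most one more. -/
theorem not_conn_or_of_loop_left (hφ : IsColoring R φ) (hxy : x ≠ y) (hxz : x ≠ z) (hyz : y ≠ z)
    (hx : φ x x = a) (hy : φ y y = a ∨ φ y y = b) (hz : φ z z = a ∨ φ z z = b) :
    ¬ Conn R φ a b x y ∨ ¬ Conn R φ a b x z := by
  choose nb hnb hnbc using hφ.surj
  have inv : ∀ c, Function.Involutive fun v => nb v c := by
    intro c v
    refine hφ.inj (hnb _ _) (hφ.rel_symm (hnb _ _)) ?_
    rw [hnbc, ← hφ.symm (hnb v c), hnbc]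
  have loop : ∀ v, nb v (φ v v) = v := fun v => hφ.inj (hnb _ _) (hφ.refl v) (hnbc _ _)
  set p := (inv a).toPerm with hp
  set q := (inv b).toPerm with hq
  have hpp : p * p = 1 := by ext v; exact inv a v
  have hqq : q * q = 1 := by ext v; exact inv b v
  set σ := q * p with hσ
  have hpx : p x = x := by
    have := loop x
    rwa [hx] at this
  have hconj : ∀ k : ℤ, p * σ ^ k = σ ^ (-k) * p := by
    intro k
    have hp' : p⁻¹ = p := inv_eq_of_mul_eq_one_left hpp
    have hq' : q⁻¹ = q := inv_eq_of_mul_eq_one_left hqq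
    have h1 : p * σ * p⁻¹ = σ⁻¹ := by
      rw [hσ, mul_inv_rev, hp', hq', mul_assoc, mul_assoc, hpp, mul_one]
    have h2 := conj_zpow (i := k) (a := p) (b := σ)
    rw [h1, inv_zpow'] at h2
    rw [h2]
    group
  have hpk : ∀ k : ℤ, p ((σ ^ k) x) = (σ ^ (-k)) x := by
    intro k
    have := congrArg (fun f : Equiv.Perm V => f x) (hconj k)
    simpa [hpx] using this
  have hqp : ∀ v, q v = σ (p v) := by
    intro v
    have : p (p v) = v := inv a v
    rw [hσ, Equiv.Perm.mul_apply, this]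
  have hqk : ∀ k : ℤ, q ((σ ^ k) x) = (σ ^ (1 - k)) x := by
    intro k
    rw [hqp, hpk, sub_eq_add_neg, zpow_add, zpow_one]
    rfl
  by_contra! hcon
  have hcl : Closed R φ a b {v | ∃ k : ℤ, (σ ^ k) x = v} := by
    rintro v w hvw hc ⟨k, rfl⟩
    rcases hc with hc | hc
    · refine ⟨-k, ?_⟩
      rw [← hpk]
      exact hφ.inj (hnb _ _) hvw ((hnbc _ _).trans hc.symm)
    · refine ⟨1 - k, ?_⟩
      rw [← hqk]
      exact hφ.inj (hnb _ _) hvw ((hnbc _ _).trans hc.symm)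
  obtain ⟨k, rfl⟩ := hcon.1 _ hcl ⟨0, rfl⟩
  obtain ⟨l, rfl⟩ := hcon.2 _ hcl ⟨0, rfl⟩
  -- Here `n` is the minimal period of `x`, which is 0 if the orbit is infinite.
  obtain ⟨n, hn⟩ : ∃ n : ℤ, ∀ j : ℤ, (σ ^ j) x = x ↔ n ∣ j :=
    ⟨_, fun j => MulAction.zpow_smul_eq_iff_minimalPeriod_dvd (a := σ) (b := x)⟩
  have hadd : ∀ i j : ℤ, (σ ^ i) x = (σ ^ j) x ↔ n ∣ i - j := by
    intro i j
    rw [← hn, sub_eq_neg_add, zpow_add, zpow_neg, Equiv.Perm.mul_apply, Equiv.Perm.inv_eq_iff_eq,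
      eq_comm, eq_comm]
  have hfix : ∀ k : ℤ, (φ ((σ ^ k) x) ((σ ^ k) x) = a ∨ φ ((σ ^ k) x) ((σ ^ k) x) = b) →
      n ∣ 2 * k ∨ n ∣ 2 * k - 1 := by
    rintro k (h | h)
    · left
      have h1 : p ((σ ^ k) x) = (σ ^ k) x := by
        have := loop ((σ ^ k) x)
        rwa [h] at this
      rw [hpk, hadd] at h1
      rw [show 2 * k = -(-k - k) by ring]
      exact h1.neg_right
    · right
      have h1 : q ((σ ^ k) x) = (σ ^ k) x := by
        have := loop ((σ ^ k) x)
        rwa [h] at this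
      rw [hqk, hadd] at h1
      rw [show 2 * k - 1 = -(1 - k - k) by ring]
      exact h1.neg_right
  rcases Int.dvd_or_of_dvd_two_mul (hfix k hy) (hfix l hz) with h | h | h
  · exact hxy ((hn k).2 h).symm
  · exact hxz ((hn l).2 h).symm
  · exact hyz ((hadd k l).2 h)

theorem Conn.comm (h : Conn R φ a b x y) : Conn R φ b a x y := fun C hC => h C hC.comm

/-- A component of the subgraph of edges coloured `a` or `b` has at most two loops. -/
theorem not_conn_or (hφ : IsColoring R φ) (hxy : x ≠ y) (hxz : x ≠ z) (hyz : y ≠ z)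
    (hx : φ x x = a ∨ φ x x = b) (hy : φ y y = a ∨ φ y y = b) (hz : φ z z = a ∨ φ z z = b) :
    ¬ Conn R φ a b x y ∨ ¬ Conn R φ a b x z := by
  rcases hx with hx | hx
  · exact not_conn_or_of_loop_left hφ hxy hxz hyz hx hy hz
  · exact (not_conn_or_of_loop_left hφ hxy hxz hyz hx hy.symm hz.symm).imp
      (fun h h' => h h'.comm) (fun h hxy => h hxy.comm)

/-! ### Cyclic fans and two situations in which they can be inverted -/

/-- `S` is a union of cyclic fans at `u`. -/
structure IsBalanced (R : V → V → Prop) (φ : V → V → K) (u : V) (S : Set V) : Prop where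
  rel : ∀ y ∈ S, R u y
  ne : ∀ y ∈ S, y ≠ u
  inj : ∀ y ∈ S, ∀ z ∈ S, φ y y = φ z z → y = z
  next : ∀ y ∈ S, ∃ z ∈ S, φ u z = φ y y

/-- `S` is a single cyclic fan at `u`. -/
structure IsCycle (R : V → V → Prop) (φ : V → V → K) (u : V) (S : Set V) : Prop where
  rel : ∀ y ∈ S, R u y
  ne : ∀ y ∈ S, y ≠ u
  next : ∀ y ∈ S, ∃ z ∈ S, φ u z = φ y y
  min : ∀ T ⊆ S, T.Nonempty → (∀ y ∈ T, ∃ z ∈ T, φ u z = φ y y) → T = S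

theorem IsBalanced.prev [Finite V] (h : IsBalanced R φ u S) :
    ∀ z ∈ S, ∃ y ∈ S, φ y y = φ u z := by
  choose f hf hfc using h.next
  let g : S → S := fun y => ⟨f y y.2, hf y y.2⟩
  have hg : Function.Injective g := by
    intro y z hyz
    refine Subtype.ext (h.inj y y.2 z z.2 ?_)
    rw [← hfc y y.2, ← hfc z z.2]
    exact congrArg (φ u) (congrArg Subtype.val hyz)
  intro z hz
  obtain ⟨y, hy⟩ := Finite.surjective_of_injective hg ⟨z, hz⟩
  refine ⟨y, y.2, ?_⟩
  rw [← hfc y y.2]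
  exact congrArg (φ u) (congrArg Subtype.val hy)

/-- The vertices that have a predecessor form a nonempty subset closed under successors, hence all
of `S` by minimality. -/
theorem IsCycle.prev (h : IsCycle R φ u S) : ∀ z ∈ S, ∃ y ∈ S, φ y y = φ u z := by
  intro z hz
  have : {z | z ∈ S ∧ ∃ y ∈ S, φ y y = φ u z} = S := by
    refine h.min _ (fun _ h => h.1) ?_ ?_
    · obtain ⟨w, hw, hwz⟩ := h.next z hz
      exact ⟨w, hw, z, hz, hwz.symm⟩
    · rintro y ⟨hy, -⟩
      obtain ⟨w, hw, hwz⟩ := h.next y hy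
      exact ⟨w, ⟨hw, y, hy, hwz.symm⟩, hwz⟩
  rw [← this] at hz
  exact hz.2

theorem IsCycle.inj [Finite V] (h : IsCycle R φ u S) (hφ : IsColoring R φ) :
    ∀ y ∈ S, ∀ z ∈ S, φ y y = φ z z → y = z := by
  choose f hf hfc using h.next
  let g : S → S := fun y => ⟨f y y.2, hf y y.2⟩
  have hg : Function.Surjective g := by
    rintro ⟨z, hz⟩
    obtain ⟨y, hy, hyz⟩ := h.prev z hz
    refine ⟨⟨y, hy⟩, Subtype.ext ?_⟩
    exact hφ.inj (h.rel _ (hf y hy)) (h.rel z hz) ((hfc y hy).trans hyz)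
  intro y hy z hz hyz
  have hg' : Function.Injective g := Finite.injective_iff_surjective.2 hg
  have := @hg' ⟨y, hy⟩ ⟨z, hz⟩
    (Subtype.ext (hφ.inj (h.rel _ (hf y hy)) (h.rel _ (hf z hz)) (by
      change φ u (f y hy) = φ u (f z hz)
      rw [hfc, hfc, hyz])))
  exact congrArg Subtype.val this

theorem IsCycle.isBalanced [Finite V] (h : IsCycle R φ u S) (hφ : IsColoring R φ) :
    IsBalanced R φ u S := ⟨h.rel, h.ne, h.inj hφ, h.next⟩

theorem IsCycle.loop_ne (h : IsCycle R φ u S) (hφ : IsColoring R φ) : ∀ y ∈ S, φ y y ≠ φ u u := by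
  intro y hy he
  obtain ⟨z, hz, hzy⟩ := h.next y hy
  exact h.ne z hz (hφ.inj (h.rel z hz) (hφ.refl u) (hzy.trans he))

theorem IsCycle.spoke_ne (h : IsCycle R φ u S) (hφ : IsColoring R φ) : ∀ y ∈ S, φ u y ≠ φ u u :=
  fun y hy he => h.ne y hy (hφ.inj (h.rel y hy) (hφ.refl u) he)

/-- Cyclic fans can be inverted if they are not saturated. -/
theorem IsCycle.reach_of_not_conn [Finite V] (hφ : IsColoring R φ) (h : IsCycle R φ u S)
    (hy : y ∈ S)
    (hn : ¬ Conn R φ (φ u u) (φ y y) u y) : Reach R φ (rot φ u S (φ u u)) := by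
  obtain ⟨C, hC, huC, hyC⟩ := exists_closed_of_not_conn hφ hn
  set s := φ y y with hs
  have hinj := h.inj hφ
  have hloop := h.loop_ne hφ
  have hspoke := h.spoke_ne hφ
  set ψ := swapOn φ (φ u u) s C with hψ
  have h1 : Reach R φ ψ := hC.reach fun _ _ _ => rfl
  have hψc := hφ.reach h1
  have e1 : ∀ z, ψ u z = φ u z := fun z => by simp [hψ, swapOn, huC]
  have e2 : ∀ z ∈ S, z ≠ y → ψ z z = φ z z := by
    intro z hz hzy
    have h1 := hloop z hz
    have h2 : φ z z ≠ s := fun he => hzy (hinj z hz y hy he)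
    simp [hψ, swapOn, h1, h2]
  have e3 : ψ y y = φ u u := by
    simp [hψ, swapOn, hyC, ← hs]
  -- The swap gives the loop at `y` the colour missing at `u`, which cuts the cycle open: the fan
  -- now starts at the successor of `y` and ends at `y`.
  have hpath : IsPath R ψ u S s := by
    refine ⟨h.rel, h.ne, ?_, ?_, ?_, ?_, ?_⟩
    · intro z hz w hw he
      have := hinj z hz w hw
      have := hloop z hz
      have := hloop w hw
      by_cases h1 : z = y <;> by_cases h2 : w = y <;> grind
    · intro z hz
      have := h.next z hz
      by_cases h1 : z = y <;> grind
    · intro T hT hTc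
      by_contra hne
      have hyT : y ∉ T := by
        intro hyT
        obtain ⟨z, hz, hzy⟩ := hTc y hyT
        have := hspoke z (hT hz)
        grind
      refine hyT ?_
      rw [h.min T hT (Set.nonempty_iff_ne_empty.2 hne) ?_]
      · exact hy
      · intro z hz
        obtain ⟨w, hw, hwz⟩ := hTc z hz
        exact ⟨w, hw, by rw [← e1, hwz, e2 z (hT hz) (fun he => hyT (he ▸ hz))]⟩
    · right
      obtain ⟨z, hz, hzy⟩ := h.next y hy
      exact ⟨z, hz, by rw [e1, hzy]⟩
    · intro z hz he
      have := hinj z hz y hy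
      have := hloop y hy
      by_cases h1 : z = y <;> grind
  have h2 : Reach R ψ (rot ψ u S s) := hpath.reach hψc
  have hsC : ∀ z ∈ S, φ u z = s → z ∉ C := by
    intro z hz hzs hzC
    exact huC (hC (hφ.rel_symm (h.rel z hz)) (.inr (by rw [← hφ.symm (h.rel z hz), hzs])) hzC)
  have hss : ∀ w, R u w → φ u w = s → w ∈ S := by
    intro w hw hws
    obtain ⟨z, hz, hzy⟩ := h.next y hy
    rwa [hφ.inj hw (h.rel z hz) (hws.trans hzy.symm)]
  have h0 : ∀ w, R u w → φ u w = φ u u → w = u := fun w hw he => hφ.inj hw (hφ.refl u) he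
  have hsymm := @hφ.symm
  have hrs := @hφ.rel_symm
  have hr := h.rel
  classical
  have e4 : ∀ z ∈ S, ψ z z = if z = y then φ u u else φ z z := by
    intro z hz
    split_ifs with hzy
    · rw [hzy, e3]
    · exact e2 z hz hzy
  -- After the shift the edge `uy` has colour `φ u u` and the loop at `u` has colour `s`, so `u` is
  -- now attached to the component of `y`; swapping back on the enlarged set also corrects these
  -- two.
  have hC' : Closed R (rot ψ u S s) (φ u u) s (insert u C) := by
    intro v w hvw hc hv
    have hCvw := @hC v w hvw
    simp only [Set.mem_insert_iff] at hv ⊢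
    rcases rot_cases ψ s h.ne v w with ⟨h1, h2, h3⟩ | ⟨h1, h2, h3, h4⟩ | ⟨h1, h2, h3, h4⟩ |
      ⟨h1, h2, h3, h4⟩ | ⟨h1, h2⟩
    · grind
    · rw [h4, e4 w h2] at hc
      grind
    · grind
    · grind
    · rw [h2, hψ, swapOn] at hc
      grind
  refine (h1.trans h2).trans (hC'.reach fun v w hvw => ?_)
  have hCvw := @hC v w hvw
  have hCwv := @hC w v (hφ.rel_symm hvw)
  simp only [swapOn, Set.mem_insert_iff]
  have h5 := rot_cases φ (φ u u) h.ne v w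
  rcases rot_cases ψ s h.ne v w with ⟨h1, h2, h3⟩ | ⟨h1, h2, h3, h4⟩ | ⟨h1, h2, h3, h4⟩ |
      ⟨h1, h2, h3, h4⟩ | ⟨h1, h2⟩
  · simp only [h1, h2, rot_self]
    grind
  · rw [h4, h1, rot_spoke h2 h3, e4 w h2]
    grind
  · rw [h4, e4 v h2]
    grind
  · rw [h4]
    grind
  · rw [h2, hψ, swapOn]
    grind

/-- A fan inversion commutes with a swap away from the centre that keeps the fan. -/
theorem reach_rot_of_swapOn (hφ : IsColoring R φ) (hr : ∀ y ∈ S, R u y) (hne : ∀ y ∈ S, y ≠ u)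
    (hC : Closed R φ a b C) (hu : u ∉ C) (hl : ∀ y ∈ S, y ∈ C → φ y y ≠ a ∧ φ y y ≠ b)
    (h : Reach R (swapOn φ a b C) (rot (swapOn φ a b C) u S d)) : Reach R φ (rot φ u S d) := by
  classical
  have hs : ∀ y ∈ S, y ∈ C → φ u y ≠ a ∧ φ u y ≠ b := by
    intro y hy hyC
    have h1 := @hC y u (hφ.rel_symm (hr y hy))
    rw [← hφ.symm (hr y hy)] at h1
    grind
  have hsl : ∀ y ∈ S, swapOn φ a b C y y = φ y y := by
    intro y hy
    have := hl y hy
    unfold swapOn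
    grind
  have hss : ∀ y, swapOn φ a b C u y = φ u y := by
    intro y
    simp [swapOn, hu]
  have hcl : Closed R (rot (swapOn φ a b C) u S d) a b C := by
    intro v w hvw hc hv
    have hCvw := @hC v w hvw
    rcases rot_cases (swapOn φ a b C) d hne v w with ⟨h1, h2, h3⟩ | ⟨h1, h2, h3, h4⟩ |
      ⟨h1, h2, h3, h4⟩ | ⟨h1, h2, h3, h4⟩ | ⟨h1, h2⟩
    · grind
    · grind
    · rw [h4, hsl v h2] at hc
      grind
    · grind
    · rw [h2, swapOn] at hc
      grind
  refine (hC.reach fun _ _ _ => rfl).trans (h.trans (hcl.reach fun v w hvw => ?_))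
  have hse : swapOn φ a b C v w =
    if v ∈ C then (if φ v w = a then b else if φ v w = b then a else φ v w) else φ v w := rfl
  simp only [swapOn]
  have h5 := rot_cases φ d hne v w
  rcases rot_cases (swapOn φ a b C) d hne v w with ⟨h1, h2, h3⟩ | ⟨h1, h2, h3, h4⟩ |
      ⟨h1, h2, h3, h4⟩ | ⟨h1, h2, h3, h4⟩ | ⟨h1, h2⟩
  · grind
  · grind
  · rw [hsl v h2] at h4
    have := hl v h2
    grind
  · rw [hss v] at h4
    have := hs v h2
    grind
  · rw [hse] at h2
    clear hse
    grind

/-- If the component of `u` in the colours of `uy` and of the loop at `y` misses the predecessor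
`z` of `y`, then inverting a cyclic fan reduces to inverting a smaller one. -/
theorem IsCycle.reach_of_not_conn_prev [Finite V] (hφ : IsColoring R φ) (h : IsCycle R φ u S)
    (hy : y ∈ S) (hz : z ∈ S) (hzy : φ z z = φ u y)
    (hn : ¬ Conn R φ (φ u y) (φ y y) u z)
    (ih : ∀ ψ : V → V → K, IsColoring R ψ → IsBalanced R ψ u (S \ {y}) →
      Reach R ψ (rot ψ u (S \ {y}) (ψ u u))) :
    Reach R φ (rot φ u S (φ u u)) := by
  classical
  obtain ⟨C, hC, huC, hzC⟩ : ∃ C, Closed R φ (φ u y) (φ y y) C ∧ u ∈ C ∧ z ∉ C := by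
    unfold Conn at hn
    push Not at hn
    exact hn
  have hinj := h.inj hφ
  have hloop := h.loop_ne hφ
  have hspoke := h.spoke_ne hφ
  have hr := h.rel
  have hne := h.ne
  have hsymm := @hφ.symm
  have hrs := @hφ.rel_symm
  have hsp : ∀ w ∈ S, ∀ v, R u v → φ u v = φ u w → v = w := fun w hw v hv he =>
    hφ.inj hv (hr w hw) he
  obtain ⟨t, ht, hty⟩ := h.next y hy
  have hyu : φ y u = φ u y := (hφ.symm (hr y hy)).symm
  have hyC : y ∈ C := hC (hr y hy) (.inl rfl) huC
  have htC : t ∈ C := hC (hr t ht) (.inr hty) huC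
  have hne12 : φ u y ≠ φ y y := by
    rw [← hyu]
    intro he
    exact hne y hy (hφ.inj (hφ.rel_symm (hr y hy)) (hφ.refl y) he).symm
  have htny : t ≠ y := by
    rintro rfl
    exact hne12 hty
  set ψ := swapOn φ (φ u y) (φ y y) C with hψ
  have h1 : Reach R φ ψ := hC.reach fun _ _ _ => rfl
  have hψc := hφ.reach h1
  have hψsymm := @hψc.symm
  have e1 : ∀ w ∈ S, w ≠ y → ψ w w = φ w w := by
    intro w hw hwy
    have h1 : φ w w ≠ φ y y := fun he => hwy (hinj w hw y hy he)
    have h2 : φ w w = φ u y → w = z := fun he => hinj w hw z hz (he.trans hzy.symm)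
    simp only [hψ, swapOn]
    grind
  have e2 : ψ y y = φ u y := by
    simp only [hψ, swapOn]
    grind
  have e3 : ψ u y = φ y y := by
    simp only [hψ, swapOn]
    grind
  have e4 : ψ u t = φ u y := by
    simp only [hψ, swapOn]
    grind
  have e5 : ∀ w, R u w → w ≠ y → w ≠ t → ψ u w = φ u w := by
    intro w hw hwy hwt
    have := hsp y hy w hw
    have := hsp t ht w hw
    simp only [hψ, swapOn]
    grind
  have e6 : ψ u u = φ u u := by
    have := hloop y hy
    have := hspoke y hy
    simp only [hψ, swapOn]
    grind
  -- The swap has exchanged `uy` with the loop at `y`, as desired, and has given `ut` the old colour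
  -- of `uy`; hence `t` now follows `z` and `y` is bypassed.
  have hbal : IsBalanced R ψ u (S \ {y}) := by
    refine ⟨fun w hw => hr w hw.1, fun w hw => hne w hw.1, ?_, ?_⟩
    · intro w hw w' hw' he
      rw [e1 w hw.1 hw.2, e1 w' hw'.1 hw'.2] at he
      exact hinj w hw.1 w' hw'.1 he
    · intro w hw
      rw [e1 w hw.1 hw.2]
      by_cases hwz : w = z
      · exact ⟨t, ⟨ht, htny⟩, by rw [e4, hwz, hzy]⟩
      · obtain ⟨w', hw', hww⟩ := h.next w hw.1
        have h1 : w' ≠ y := by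
          rintro rfl
          exact hwz (hinj w hw.1 z hz (hww.symm.trans hzy.symm))
        have h2 : w' ≠ t := by
          rintro rfl
          exact hw.2 (hinj w hw.1 y hy (hww.symm.trans hty))
        exact ⟨w', ⟨hw', h1⟩, by rw [e5 w' (hr w' hw') h1 h2, hww]⟩
  have h2 := ih ψ hψc hbal
  rw [e6] at h2
  have mem : ∀ w, w ∈ S \ {y} ↔ w ∈ S ∧ w ≠ y := by simp
  have hψe : ∀ v w, ψ v w =
      if v ∈ C then (if φ v w = φ u y then φ y y else if φ v w = φ y y then φ u y
      else φ v w) else φ v w := by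
    intro v w
    simp only [hψ, swapOn]
  -- After the inversion `uz` has the old colour of `uy`, and `z ∉ C`. So `u` and `y` are cut off
  -- from the rest of `C`, which can be swapped back without them.
  have hcl : Closed R (rot ψ u (S \ {y}) (φ u u)) (φ u y) (φ y y) (C \ {u, y}) := by
    intro v w hvw hc hv
    have hCvw := @hC v w hvw
    simp only [Set.mem_sdiff, Set.mem_insert_iff, Set.mem_singleton_iff] at hv ⊢
    have h6 := hψe v w
    have h7 := hφ.rel_symm hvw
    have h8 := hφ.symm hvw
    have h9 := hsp y hy v
    have h10 := hsp t ht v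
    have h11 := @hφ.inj y v u
    have h12 := @hφ.inj y v y
    have h13 := hφ.refl y
    have h14 := hrs (hr y hy)
    rcases rot_cases ψ (φ u u) hbal.ne v w with ⟨h1, h2, h3⟩ | ⟨h1, h2, h3, h4⟩ |
      ⟨h1, h2, h3, h4⟩ | ⟨h1, h2, h3, h4⟩ | ⟨h1, h2⟩
    · grind
    · grind
    · rw [mem] at h2
      rw [h4, e1 v h2.1 h2.2] at hc
      have := hinj v h2.1 y hy
      have := hinj v h2.1 z hz
      grind
    · grind
    · rw [h2] at hc
      rw [mem, mem] at h1
      clear h2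
      grind
  refine h1.trans (h2.trans (hcl.reach fun v w hvw => ?_))
  have h6 := hψe v w
  have h7 := hφ.rel_symm hvw
  have h8 := hφ.symm hvw
  have hCvw := @hC v w hvw
  have hCwv := @hC w v h7
  simp only [swapOn, Set.mem_sdiff, Set.mem_insert_iff, Set.mem_singleton_iff]
  have h5 := rot_cases φ (φ u u) h.ne v w
  rcases rot_cases ψ (φ u u) hbal.ne v w with ⟨h1, h2, h3⟩ | ⟨h1, h2, h3, h4⟩ |
      ⟨h1, h2, h3, h4⟩ | ⟨h1, h2, h3, h4⟩ | ⟨h1, h2⟩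
  · rw [h3, h1, h2, rot_self]
    grind
  · rw [mem] at h2
    rw [h4, h1, rot_spoke h2.1 h3, e1 w h2.1 h2.2]
    grind
  · rw [mem] at h2
    rw [e1 v h2.1 h2.2] at h4
    have := hinj v h2.1 y hy
    have := hinj v h2.1 z hz
    grind
  · rw [mem] at h2
    rw [h4, ← h1, rot_loop h2.1 h3]
    have := e5 v (hr v h2.1) h2.2
    have := hsp y hy v (hr v h2.1)
    have := hsp t ht v (hr v h2.1)
    grind
  · rw [mem, mem] at h1
    have h11 := @hφ.inj y v u
    have h11' := @hφ.inj y w u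
    have h12 := @hφ.inj y v y
    have h12' := @hφ.inj y w y
    have h13 := hφ.refl y
    have h14 := hrs (hr y hy)
    have h15 := hsp y hy w
    have h16 := hsp t ht w
    have h17 := hsp y hy v
    have h18 := hsp t ht v
    rw [h2, h6]
    clear h2 h6 hψe
    grind

/-! ### Fans at two adjacent centres -/

/-- The underlying simple graph of `R` has no triangle. -/
def TriangleFree (R : V → V → Prop) : Prop :=
  ∀ x y z, R x y → R y z → R x z → x = y ∨ y = z ∨ x = z

theorem rot_symm (hφ : IsColoring R φ) (hS : ∀ y ∈ S, y ≠ u) (hvw : R v w) :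
    rot φ u S d v w = rot φ u S d w v := by
  have h := hφ.symm hvw
  have h1 := rot_cases φ d hS w v
  rcases rot_cases φ d hS v w with ⟨h1, h2, h3⟩ | ⟨h1, h2, h3, h4⟩ |
      ⟨h1, h2, h3, h4⟩ | ⟨h1, h2, h3, h4⟩ | ⟨h1, h2⟩ <;> grind

/-- Used to compare compositions of rotations centred at `u` and `y`: by symmetry only edges at the
two centres, other loops and edges avoiding both centres need checking. -/
theorem agree_of (hφ : ∀ {v w}, R v w → φ v w = φ w v) (hψ : ∀ {v w}, R v w → ψ v w = ψ w v)
    (hR : ∀ {v w}, R v w → R w v)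
    (hu : ∀ w, R u w → φ u w = ψ u w) (hy : ∀ w, R y w → φ y w = ψ y w)
    (hl : ∀ v, v ≠ u → v ≠ y → φ v v = ψ v v)
    (h : ∀ v w, v ≠ w → v ≠ u → v ≠ y → w ≠ u → w ≠ y → φ v w = ψ v w) :
    ∀ v w, R v w → φ v w = ψ v w := by
  intro v w hvw
  by_cases h1 : v = u
  · rw [h1] at hvw ⊢
    exact hu w hvw
  by_cases h2 : v = y
  · rw [h2] at hvw ⊢
    exact hy w hvw
  by_cases h3 : w = u
  · rw [hφ hvw, hψ hvw, h3]
    exact hu v (h3 ▸ hR hvw)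
  by_cases h4 : w = y
  · rw [hφ hvw, hψ hvw, h4]
    exact hy v (h4 ▸ hR hvw)
  by_cases h5 : v = w
  · rw [← h5]
    exact hl v h1 h2
  · exact h v w h5 h1 h2 h3 h4

theorem TriangleFree.disjoint (hT : TriangleFree R) (hyu : y ≠ u) (hu : R u y)
    (hS : ∀ x ∈ S, R u x ∧ x ≠ u) (hZ : ∀ x ∈ Z, R y x ∧ x ≠ y) : ∀ x ∈ Z, x ∉ S := by
  intro x hx hxS
  rcases hT u y x hu (hZ x hx).1 (hS x hxS).1 with h | h | h
  · exact hyu h.symm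
  · exact (hZ x hx).2 h.symm
  · exact (hS x hxS).2 h.symm

/-- A cyclic fan at `u` through `y` can be inverted if a cyclic fan at `y` through `u` can be
inverted. -/
theorem IsCycle.reach_of_isCycle [Finite V] (hφ : IsColoring R φ) (hT : TriangleFree R)
    (h : IsCycle R φ u S) (hy : y ∈ S) (hZ : IsCycle R φ y Z) (hu : u ∈ Z)
    (hinv : Reach R φ (rot φ y Z (φ y y))) : Reach R φ (rot φ u S (φ u u)) := by
  have hinj := h.inj hφ
  have hloop := h.loop_ne hφ
  have hspoke := h.spoke_ne hφ
  have hZinj := hZ.inj hφ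
  have huy := h.rel y hy
  have hyu := hφ.rel_symm huy
  have hyne := h.ne y hy
  have hs := hφ.symm huy
  have hdis := hT.disjoint hyne huy (fun x hx => ⟨h.rel x hx, h.ne x hx⟩)
    (fun x hx => ⟨hZ.rel x hx, hZ.ne x hx⟩)
  have hyZ : y ∉ Z := fun h' => hZ.ne y h' rfl
  have huS : u ∉ S := fun h' => h.ne u h' rfl
  set ψ := rot φ y Z (φ y y) with hψ
  have hψc := hφ.reach hinv
  have p1 : ψ u u = φ u y := by rw [hψ, rot_loop hu hyne.symm, hs]
  have p2 : ψ u y = φ u u := by rw [hψc.symm huy, hψ, rot_spoke hu hyne.symm]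
  have p3 : ∀ w, w ≠ u → w ≠ y → ψ u w = φ u w := fun w h1 h2 => by
    rw [hψ, rot_of_ne hyne.symm h2 h1.symm]
  have p4 : ∀ x ∈ S, ψ x x = φ x x := by
    intro x hx
    by_cases hxy : x = y
    · rw [hxy, hψ, rot_self]
    · rw [hψ, rot_of_notMem (fun h' => hdis x h' hx) hxy]
  -- Inverting `Z` has exchanged `uy` with the loop at `u`, so the fan along `S` now starts at `y`
  -- and ends at the predecessor of `y`.
  have hpath : IsPath R ψ u S (φ u u) := by
    refine ⟨h.rel, h.ne, ?_, ?_, ?_, ?_, ?_⟩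
    · intro x hx x' hx' he
      rw [p4 x hx, p4 x' hx'] at he
      exact hinj x hx x' hx' he
    · intro x hx
      rw [p4 x hx, p1]
      obtain ⟨x', hx', he⟩ := h.next x hx
      by_cases hxy : x' = y
      · left; rw [← he, hxy]
      · exact .inr ⟨x', hx', by rw [p3 x' (h.ne x' hx') hxy, he]⟩
    · intro T hTS hTc
      by_contra hne
      have hTy : ∀ x ∈ T, ∃ x' ∈ T, x' ≠ y ∧ φ u x' = φ x x := by
        intro x hx
        obtain ⟨x', hx', he⟩ := hTc x hx
        rw [p4 x (hTS hx)] at he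
        have : x' ≠ y := by
          rintro rfl
          exact hloop x (hTS hx) (he.symm.trans p2)
        exact ⟨x', hx', this, by rw [← p3 x' (h.ne x' (hTS hx')) this, he]⟩
      have hTS' := h.min T hTS (Set.nonempty_iff_ne_empty.2 hne) fun x hx => by
        obtain ⟨x', hx', -, he⟩ := hTy x hx
        exact ⟨x', hx', he⟩
      obtain ⟨x, hx, hxy⟩ := h.prev y hy
      obtain ⟨x', hx', hne', he⟩ := hTy x (hTS' ▸ hx)
      exact hne' (hφ.inj (h.rel x' (hTS hx')) huy (he.trans hxy))
    · exact .inr ⟨y, hy, p2⟩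
    · intro x hx
      rw [p4 x hx]
      exact hloop x hx
  have h2 := hpath.reach hψc
  set χ := rot ψ u S (φ u u) with hχ
  have hχc := hψc.reach h2
  have q1 : χ y y = φ u u := by rw [hχ, rot_loop hy hyne, p2]
  have q2 : ∀ x ∈ Z, x ≠ u → χ y x = φ x x := by
    intro x hx hxu
    rw [hχ, rot_of_ne hyne hxu (hZ.ne x hx).symm, hψ, rot_spoke hx (hZ.ne x hx)]
  have q3 : ∀ x ∈ Z, x ≠ u → χ x x = φ y x := by
    intro x hx hxu
    rw [hχ, rot_of_notMem (hdis x hx) hxu, hψ, rot_loop hx (hZ.ne x hx)]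
  -- The inverted fan at `y` runs backwards; with `u` removed it is a path, and shifting it undoes
  -- the inversion of `Z` outside `u`.
  have hpath' : IsPath R χ y (Z \ {u}) (φ u y) := by
    refine ⟨fun x hx => hZ.rel x hx.1, fun x hx => hZ.ne x hx.1, ?_, ?_, ?_, ?_, ?_⟩
    · intro x hx x' hx' he
      rw [q3 x hx.1 hx.2, q3 x' hx'.1 hx'.2] at he
      exact hφ.inj (hZ.rel x hx.1) (hZ.rel x' hx'.1) he
    · intro x hx
      rw [q3 x hx.1 hx.2, q1]
      obtain ⟨x', hx', he⟩ := hZ.prev x hx.1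
      by_cases hxu : x' = u
      · left; rw [← he, hxu]
      · exact .inr ⟨x', ⟨hx', hxu⟩, by rw [q2 x' hx' hxu, he]⟩
    -- In `Z`, the complement of a set closed under predecessors is closed under successors; as it
    -- contains `u`, minimality makes it all of `Z`.
    · intro T hTZ hTc
      have := hZ.min (Z \ T) Set.sdiff_subset ⟨u, hu, fun h' => (hTZ h').2 rfl⟩ ?_
      · exact Set.eq_empty_of_forall_notMem fun x hx =>
          (this.symm ▸ (hTZ hx).1 : x ∈ Z \ T).2 hx
      · intro x hx
        obtain ⟨x', hx', he⟩ := hZ.next x hx.1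
        refine ⟨x', ⟨hx', fun hx'T => ?_⟩, he⟩
        obtain ⟨x'', hx'', he'⟩ := hTc x' hx'T
        have h1 := hTZ hx'T
        have h2 := hTZ hx''
        rw [q2 x'' h2.1 h2.2, q3 x' h1.1 h1.2] at he'
        have := hZinj x'' h2.1 x hx.1 (he'.trans he)
        exact hx.2 (this ▸ hx'')
    · right
      obtain ⟨x, hx, he⟩ := hZ.prev u hu
      have hxu : x ≠ u := by
        rintro rfl
        exact hyne.symm (hφ.inj (hφ.refl x) huy (he.trans hs.symm))
      exact ⟨x, ⟨hx, hxu⟩, by rw [q2 x hx hxu, he, hs]⟩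
    · intro x hx he
      rw [q3 x hx.1 hx.2, hs] at he
      exact hx.2 (hφ.inj (hZ.rel x hx.1) hyu he)
  have h3 := hpath'.reach hχc
  refine (hinv.trans (h2.trans h3)).congr ?_
  have hZ' := hpath'.ne
  refine agree_of (u := u) (y := y) (rot_symm hφ h.ne) (rot_symm hχc hZ') hφ.rel_symm ?_ ?_ ?_ ?_
  · intro w hw
    have huZ : u ∉ Z \ {u} := fun h' => h'.2 rfl
    rw [rot_of_notMem huZ hyne.symm]
    by_cases hwu : w = u
    · rw [hwu, hχ, rot_self, rot_self]
    by_cases hwS : w ∈ S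
    · rw [hχ, rot_spoke hwS hwu, rot_spoke hwS hwu, p4 w hwS]
    · rw [hχ, rot_spoke_of_notMem hwS hwu, rot_spoke_of_notMem hwS hwu,
        p3 w hwu (fun h' => hwS (h' ▸ hy))]
  · intro w hw
    by_cases hwy : w = y
    · rw [hwy, rot_self, rot_loop hy hyne]
    by_cases hwu : w = u
    · have huZ : u ∉ Z \ {u} := fun h' => h'.2 rfl
      rw [hwu, rot_spoke_of_notMem huZ hyne.symm, ← rot_symm hφ h.ne huy, rot_spoke hy hyne,
        hχc.symm hyu, hχ, rot_spoke hy hyne, p4 y hy]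
    rw [rot_of_ne hyne hwu (Ne.symm hwy)]
    by_cases hwZ : w ∈ Z
    · rw [rot_spoke (show w ∈ Z \ {u} from ⟨hwZ, hwu⟩) hwy, q3 w hwZ hwu]
    · rw [rot_spoke_of_notMem (fun h' => hwZ h'.1) hwy, hχ, rot_of_ne hyne hwu (Ne.symm hwy), hψ,
        rot_spoke_of_notMem hwZ hwy]
  · intro w hwu hwy
    by_cases hwZ : w ∈ Z
    · rw [rot_loop (show w ∈ Z \ {u} from ⟨hwZ, hwu⟩) hwy, q2 w hwZ hwu,
        rot_of_notMem (hdis w hwZ) hwu]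
    · rw [rot_of_notMem (fun h' => hwZ h'.1) hwy]
      by_cases hwS : w ∈ S
      · rw [hχ, rot_loop hwS hwu, rot_loop hwS hwu, p3 w hwu hwy]
      · rw [hχ, rot_of_notMem hwS hwu, rot_of_notMem hwS hwu, hψ, rot_of_notMem hwZ hwy]
  · intro v w hvw hvu hvy hwu hwy
    rw [rot_of_ne hvu hwu hvw, rot_of_ne hvy hwy hvw, hχ, rot_of_ne hvu hwu hvw, hψ,
      rot_of_ne hvy hwy hvw]

/-- A cyclic fan at `u` through `y` can be inverted if some fan at `y` that starts at `u` can be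
shifted; here `z` is the predecessor of `y`, and `x` is the last vertex of the fan at `y`. -/
theorem IsCycle.reach_of_isPath [Finite V] (hφ : IsColoring R φ) (hT : TriangleFree R)
    (h : IsCycle R φ u S) (hy : y ∈ S) (hz : z ∈ S) (hzy : φ z z = φ u y)
    (hn : Conn R φ (φ u y) (φ y y) u z)
    (hZ : IsPath R φ y Z (φ y u)) (hu : u ∈ Z) (hx : x ∈ Z) (hxy : φ x x = φ y y)
    (hprev : ∀ w ∈ Z, w ≠ u → ∃ v ∈ Z, φ v v = φ y w)
    (hmin : ∀ T ⊆ Z, T.Nonempty →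
      (∀ w ∈ T, ∃ v ∈ T, w ≠ u ∧ φ v v = φ y w ∨ w = u ∧ φ v v = φ y y) → T = Z) :
    Reach R φ (rot φ u S (φ u u)) := by
  have hinj := h.inj hφ
  have hloop := h.loop_ne hφ
  have hspoke := h.spoke_ne hφ
  have huy := h.rel y hy
  have hyu := hφ.rel_symm huy
  have hyne := h.ne y hy
  have hs := hφ.symm huy
  have hdis := hT.disjoint hyne huy (fun x hx => ⟨h.rel x hx, h.ne x hx⟩)
    (fun x hx => ⟨hZ.rel x hx, hZ.ne x hx⟩)
  have hyZ : y ∉ Z := fun h' => hZ.ne y h' rfl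
  have huS : u ∉ S := fun h' => h.ne u h' rfl
  have hxu : x ≠ u := by
    rintro rfl
    exact hloop y hy hxy.symm
  have hyz : y ≠ z := by
    rintro rfl
    rw [hs] at hzy
    exact hyne (hφ.inj (hφ.refl _) hyu hzy)
  have hxz : x ≠ z := by
    rintro rfl
    exact hdis x hx hz
  -- The loops at `y` and `z` lie in one component by `hn`, so the third loop, at `x`, is elsewhere.
  obtain ⟨C, hC, hyC, hxC⟩ : ∃ C, Closed R φ (φ u y) (φ y y) C ∧ y ∉ C ∧ x ∈ C := by
    rcases not_conn_or hφ (a := φ u y) (b := φ y y) hyz (hZ.ne x hx).symm hxz.symm (.inr rfl)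
      (.inl hzy) (.inr hxy) with h' | h'
    · exact absurd (fun C hC hyC => hn C hC (hC hyu (.inl hs.symm) hyC)) h'
    · exact exists_closed_of_not_conn hφ h'
  have huC : u ∉ C := fun h' => hyC (hC huy (.inl rfl) h')
  have hzC : z ∉ C := fun h' => huC (hn.symm hφ C hC h')
  have h1 := hZ.reach hφ
  set ψ := rot φ y Z (φ y u) with hψ
  have hψc := hφ.reach h1
  have p0 : ψ y y = φ u y := by rw [hψ, rot_self, hs]
  have p1 : ψ u u = φ u y := by rw [hψ, rot_loop hu hyne.symm, hs]
  have p2 : ψ u y = φ u u := by rw [hψc.symm huy, hψ, rot_spoke hu hyne.symm]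
  have p3 : ∀ w, w ≠ u → w ≠ y → ψ u w = φ u w := fun w h1 h2 => by
    rw [hψ, rot_of_ne hyne.symm h2 h1.symm]
  have p4 : ∀ x ∈ S, x ≠ y → ψ x x = φ x x := by
    intro x hx hxy
    rw [hψ, rot_of_notMem (fun h' => hdis x h' hx) hxy]
  -- The shift at `y` has given the loop at `u` the old colour of `uy`, so the fan from the
  -- successor of `y` to `z` can be shifted.
  have hpath : IsPath R ψ u (S \ {y}) (φ y y) := by
    refine ⟨fun x hx => h.rel x hx.1, fun x hx => h.ne x hx.1, ?_, ?_, ?_, ?_, ?_⟩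
    · intro x hx x' hx' he
      rw [p4 x hx.1 hx.2, p4 x' hx'.1 hx'.2] at he
      exact hinj x hx.1 x' hx'.1 he
    · intro x hx
      rw [p4 x hx.1 hx.2, p1]
      obtain ⟨x', hx', he⟩ := h.next x hx.1
      by_cases hxy : x' = y
      · left; rw [← he, hxy]
      · exact .inr ⟨x', ⟨hx', hxy⟩, by rw [p3 x' (h.ne x' hx') hxy, he]⟩
    · intro T hTS hTc
      by_contra hne
      have hTS' := h.min T (hTS.trans Set.sdiff_subset) (Set.nonempty_iff_ne_empty.2 hne)
        fun x hx => by
          obtain ⟨x', hx', he⟩ := hTc x hx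
          have h1 := hTS hx
          have h2 := hTS hx'
          rw [p4 x h1.1 h1.2, p3 x' (h.ne x' h2.1) h2.2] at he
          exact ⟨x', hx', he⟩
      exact (hTS (hTS' ▸ hy)).2 rfl
    · right
      obtain ⟨t, ht, he⟩ := h.next y hy
      have hty : t ≠ y := by
        rintro rfl
        rw [hs] at he
        exact hyne.symm (hφ.inj hyu (hφ.refl _) he)
      exact ⟨t, ⟨ht, hty⟩, by rw [p3 t (h.ne t ht) hty, he]⟩
    · intro x hx he
      rw [p4 x hx.1 hx.2] at he
      exact hx.2 (hinj x hx.1 y hy he)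
  have h2 := hpath.reach hψc
  set χ := rot ψ u (S \ {y}) (φ y y) with hχ
  have hχc := hψc.reach h2
  have hyS : y ∉ S \ {y} := fun h' => h'.2 rfl
  have q0 : χ y y = φ u y := by rw [hχ, rot_of_notMem hyS hyne, p0]
  have q1 : ∀ x ∈ Z, χ y x = φ x x := by
    intro x hx
    rw [hχ, rot_of_notMem hyS hyne, hψ, rot_spoke hx (hZ.ne x hx)]
  have q2 : ∀ x ∈ Z, x ≠ u → χ x x = φ y x := by
    intro x hx hxu
    rw [hχ, rot_of_notMem (fun h' => hdis x hx h'.1) hxu, hψ, rot_loop hx (hZ.ne x hx)]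
  have q3 : χ u u = φ y y := by rw [hχ, rot_self]
  -- The second shift gives the loop at `u` the colour `φ y y`, which `yx` received in the first;
  -- this closes the reversed path along `Z` into a cycle.
  have hcyc : IsCycle R χ y Z := by
    refine ⟨hZ.rel, hZ.ne, ?_, ?_⟩
    · intro w hw
      by_cases hwu : w = u
      · exact ⟨x, hx, by rw [hwu, q1 x hx, q3, hxy]⟩
      · obtain ⟨v, hv, he⟩ := hprev w hw hwu
        exact ⟨v, hv, by rw [q1 v hv, q2 w hw hwu, he]⟩
    · intro T hTZ hTn hTc
      refine hmin T hTZ hTn fun w hw => ?_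
      obtain ⟨v, hv, he⟩ := hTc w hw
      rw [q1 v (hTZ hv)] at he
      by_cases hwu : w = u
      · exact ⟨v, hv, .inr ⟨hwu, by rw [he, hwu, q3]⟩⟩
      · exact ⟨v, hv, .inl ⟨hwu, by rw [he, q2 w (hTZ hw) hwu]⟩⟩
  -- The vertex `y` is now joined to `x`, hence to `C`, while `u` stays outside. So the cycle is
  -- unsaturated at `u`, and inverting it restores `Z`.
  have hnc : ¬ Conn R χ (χ y y) (χ u u) y u := by
    rw [q0, q3]
    intro hcon
    refine (hcon (insert y C) ?_ (Set.mem_insert _ _)).elim hyne.symm huC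
    intro v w hvw hc hv
    by_cases hwy : w = y
    · exact .inl hwy
    refine .inr ?_
    by_cases hvy : v = y
    · have : w = x := by
        subst hvy
        rcases hc with hc | hc
        · exact absurd (hχc.inj hvw (hχc.refl _) (hc.trans q0.symm)) hwy
        · exact hχc.inj hvw (hZ.rel x hx) (hc.trans (by rw [q1 x hx, hxy]))
      rwa [this]
    have hvC : v ∈ C := hv.resolve_left hvy
    have hvu : v ≠ u := fun h' => huC (h' ▸ hvC)
    by_cases hwv : v = w
    · exact hwv ▸ hvC
    by_cases hwu : w = u
    · exfalso
      subst hwu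
      have hwv' := hφ.rel_symm hvw
      rw [hχc.symm hvw] at hc
      by_cases hvS : v ∈ S
      · rw [hχ, rot_spoke (show v ∈ S \ {y} from ⟨hvS, hvy⟩) hvu, p4 v hvS hvy] at hc
        rcases hc with hc | hc
        · exact hzC (hinj v hvS z hz (hc.trans hzy.symm) ▸ hvC)
        · exact hvy (hinj v hvS y hy hc)
      · rw [hχ, rot_spoke_of_notMem (fun h' => hvS h'.1) hvu, p3 v hvu hvy, hφ.symm hwv'] at hc
        exact huC (hC hvw hc hvC)
    · rw [hχ, rot_of_ne hvu hwu hwv, hψ, rot_of_ne hvy hwy hwv] at hc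
      exact hC hvw hc hvC
  have h3 := hcyc.reach_of_not_conn hχc hu hnc
  rw [q0] at h3
  refine (h1.trans (h2.trans h3)).congr ?_
  refine agree_of (u := u) (y := y) (rot_symm hφ h.ne) (rot_symm hχc hZ.ne) hφ.rel_symm ?_ ?_ ?_ ?_
  · intro w hw
    by_cases hwu : w = u
    · rw [hwu, rot_self, rot_loop hu hyne.symm, q1 u hu]
    by_cases hwy : w = y
    · rw [hwy, rot_spoke hy hyne, ← rot_symm hχc hZ.ne hyu, rot_spoke hu hyne.symm, q3]
    rw [rot_of_ne hyne.symm hwy (Ne.symm hwu)]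
    by_cases hwS : w ∈ S
    · rw [rot_spoke hwS hwu, hχ, rot_spoke (show w ∈ S \ {y} from ⟨hwS, hwy⟩) hwu, p4 w hwS hwy]
    · rw [rot_spoke_of_notMem hwS hwu, hχ, rot_spoke_of_notMem (fun h' => hwS h'.1) hwu,
        p3 w hwu hwy]
  · intro w hw
    by_cases hwy : w = y
    · rw [hwy, rot_self, rot_loop hy hyne]
    by_cases hwu : w = u
    · rw [hwu, rot_spoke hu hyne.symm, ← rot_symm hφ h.ne huy, rot_spoke hy hyne, q3]
    rw [rot_of_ne hyne hwu (Ne.symm hwy)]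
    by_cases hwZ : w ∈ Z
    · rw [rot_spoke hwZ hwy, q2 w hwZ hwu]
    · rw [rot_spoke_of_notMem hwZ hwy, hχ, rot_of_ne hyne hwu (Ne.symm hwy), hψ,
        rot_spoke_of_notMem hwZ hwy]
  · intro w hwu hwy
    by_cases hwZ : w ∈ Z
    · rw [rot_loop hwZ hwy, q1 w hwZ, rot_of_notMem (hdis w hwZ) hwu]
    · rw [rot_of_notMem hwZ hwy]
      by_cases hwS : w ∈ S
      · rw [hχ, rot_loop hwS hwu, rot_loop (show w ∈ S \ {y} from ⟨hwS, hwy⟩) hwu, p3 w hwu hwy]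
      · rw [hχ, rot_of_notMem hwS hwu, rot_of_notMem (fun h' => hwS h'.1) hwu, hψ,
          rot_of_notMem hwZ hwy]
  · intro v w hvw hvu hvy hwu hwy
    rw [rot_of_ne hvu hwu hvw, rot_of_ne hvy hwy hvw, hχ, rot_of_ne hvu hwu hvw, hψ,
      rot_of_ne hvy hwy hvw]

/-! ### Iterating the successor map of a fan -/

/-- The vertex that follows `y` in the fan at `u`. -/
noncomputable def fanNext (R : V → V → Prop) (φ : V → V → K) (u y : V) : V :=
  @Classical.epsilon V ⟨u⟩ fun w => R u w ∧ φ u w = φ y y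

theorem IsColoring.rel_fanNext (hφ : IsColoring R φ) (u y : V) : R u (fanNext R φ u y) :=
  (Classical.epsilon_spec (hφ.surj u (φ y y))).1

theorem IsColoring.color_fanNext (hφ : IsColoring R φ) (u y : V) :
    φ u (fanNext R φ u y) = φ y y :=
  (Classical.epsilon_spec (hφ.surj u (φ y y))).2

theorem IsColoring.fanNext_eq (hφ : IsColoring R φ) (hw : R u w) (h : φ u w = φ y y) :
    fanNext R φ u y = w :=
  hφ.inj (hφ.rel_fanNext u y) hw ((hφ.color_fanNext u y).trans h.symm)

theorem IsColoring.fanNext_self (hφ : IsColoring R φ) (u : V) : fanNext R φ u u = u :=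
  hφ.fanNext_eq (hφ.refl u) rfl

/-- The fan at `u` that starts at `s`. -/
noncomputable def fan (R : V → V → Prop) (φ : V → V → K) (u s : V) (k : ℕ) : V :=
  (fanNext R φ u)^[k] s


theorem fan_succ (k : ℕ) : fan R φ u s (k + 1) = fanNext R φ u (fan R φ u s k) :=
  Function.iterate_succ_apply' _ _ _

theorem fan_add {i j : ℕ} (k : ℕ) (h : fan R φ u s i = fan R φ u s j) :
    fan R φ u s (i + k) = fan R φ u s (j + k) := by
  induction k with
  | zero => exact h
  | succ k ih => rw [← add_assoc, ← add_assoc, fan_succ, fan_succ, ih]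

theorem IsColoring.fan_rel (hφ : IsColoring R φ) (hs : R u s) : ∀ k, R u (fan R φ u s k)
  | 0 => hs
  | k + 1 => by rw [fan_succ]; exact hφ.rel_fanNext _ _

theorem IsColoring.color_fan_succ (hφ : IsColoring R φ) (k : ℕ) :
    φ u (fan R φ u s (k + 1)) = φ (fan R φ u s k) (fan R φ u s k) := by
  rw [fan_succ, hφ.color_fanNext]

theorem IsColoring.fan_succ_eq (hφ : IsColoring R φ) {k : ℕ} (hw : R u w)
    (h : φ u w = φ (fan R φ u s k) (fan R φ u s k)) : fan R φ u s (k + 1) = w := by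
  rw [fan_succ]
  exact hφ.fanNext_eq hw h

/-- A fan that reaches its centre can be shifted. -/
theorem IsColoring.exists_isPath (hφ : IsColoring R φ) (hs : R u s) (hne : s ≠ u)
    (h : ∃ k, fan R φ u s k = u) :
    ∃ Z, IsPath R φ u Z (φ u s) ∧ s ∈ Z ∧ (∃ x ∈ Z, φ x x = φ u u) ∧
      (∀ w ∈ Z, w ≠ s → ∃ v ∈ Z, φ v v = φ u w) ∧
      ∀ T ⊆ Z, T.Nonempty →
        (∀ w ∈ T, ∃ v ∈ T, w ≠ s ∧ φ v v = φ u w ∨ w = s ∧ φ v v = φ u u) → T = Z := by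
  classical
  set f := fan R φ u s with hf
  obtain ⟨n, hn, hmin⟩ : ∃ n, f (n + 1) = u ∧ ∀ k < n + 1, f k ≠ u := by
    have h0 : Nat.find h ≠ 0 := fun h' => hne (by have := Nat.find_spec h; rwa [h'] at this)
    obtain ⟨n, hn⟩ := Nat.exists_eq_succ_of_ne_zero h0
    exact ⟨n, by have := Nat.find_spec h; rwa [hn] at this,
      fun k hk => Nat.find_min h (by omega)⟩
  -- A repetition before the first visit to `u` would bring that visit forward.
  have hlt : ∀ i j, i < j → j ≤ n + 1 → f i ≠ f j := by
    intro i j hij hj he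
    have := fan_add (n + 1 - j) he
    rw [show j + (n + 1 - j) = n + 1 by omega] at this
    exact hmin (i + (n + 1 - j)) (by omega) (this.trans hn)
  have hinj : ∀ i j, i ≤ n + 1 → j ≤ n + 1 → f i = f j → i = j := by
    intro i j hi hj he
    rcases lt_trichotomy i j with h | h | h
    · exact absurd he (hlt i j h hj)
    · exact h
    · exact absurd he.symm (hlt j i h hi)
  have hlinj : ∀ i j, i ≤ n → j ≤ n → φ (f i) (f i) = φ (f j) (f j) → i = j := by
    intro i j hi hj he
    have := hinj (i + 1) (j + 1) (by omega) (by omega) (by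
      rw [hf, fan_succ]
      refine hφ.fanNext_eq (hφ.fan_rel hs _) ?_
      rw [hφ.color_fan_succ]
      exact he.symm)
    omega
  refine ⟨{v | ∃ k ≤ n, f k = v}, ⟨?_, ?_, ?_, ?_, ?_, ?_, ?_⟩, ⟨0, by omega, rfl⟩,
    ⟨f n, ⟨n, le_rfl, rfl⟩, ?_⟩, ?_, ?_⟩
  · rintro y ⟨k, hk, rfl⟩
    exact hφ.fan_rel hs k
  · rintro y ⟨k, hk, rfl⟩
    exact hmin k (by omega)
  · rintro y ⟨k, hk, rfl⟩ z ⟨l, hl, rfl⟩ he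
    rw [hlinj k l hk hl he]
  · rintro y ⟨k, hk, rfl⟩
    rcases Nat.lt_or_ge k n with hkn | hkn
    · exact .inr ⟨f (k + 1), ⟨k + 1, hkn, rfl⟩, hφ.color_fan_succ k⟩
    · left
      obtain rfl : k = n := by omega
      rw [hf, ← hφ.color_fan_succ k, ← hf, hn]
  · intro T hT hTc
    refine Set.eq_empty_of_forall_notMem fun v hv => ?_
    obtain ⟨k, hk, rfl⟩ := hT hv
    have : ∀ i, f (k + i) ∈ T := by
      intro i
      induction i with
      | zero => exact hv
      | succ i ih =>
        obtain ⟨z, hz, he⟩ := hTc _ ih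
        obtain ⟨l, hl, rfl⟩ := hT hz
        have : f (k + i + 1) = f l := hφ.fan_succ_eq (hφ.fan_rel hs l) he
        rw [← add_assoc, this]
        exact hz
    have h1 := this (n + 1 - k)
    rw [show k + (n + 1 - k) = n + 1 by omega, hn] at h1
    obtain ⟨l, hl, he⟩ := hT h1
    exact hmin l (by omega) he
  · exact .inr ⟨s, ⟨0, by omega, rfl⟩, rfl⟩
  · rintro y ⟨k, hk, rfl⟩ he
    have h1 : f (k + 1) = f 0 := hφ.fan_succ_eq hs he.symm
    have := hinj (k + 1) 0 (by omega) (by omega) h1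
    omega
  · rw [hf, ← hφ.color_fan_succ n, ← hf, hn]
  · rintro w ⟨k, hk, rfl⟩ hw
    obtain ⟨l, rfl⟩ := Nat.exists_eq_succ_of_ne_zero (show k ≠ 0 by rintro rfl; exact hw rfl)
    exact ⟨f l, ⟨l, by omega, rfl⟩, (hφ.color_fan_succ l).symm⟩
  -- The relation is the predecessor relation with the start linked to the last vertex: it leads
  -- from any vertex down to `s`, then to `f n`, then through all of the fan.
  · intro T hT ⟨w, hw⟩ hTc
    have hdown : ∀ k ≤ n, f k ∈ T → ∀ l ≤ k, f l ∈ T := by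
      intro k
      induction k with
      | zero =>
        intro _ h l hl
        obtain rfl : l = 0 := by omega
        exact h
      | succ k ih =>
        intro hk h l hl
        rcases Nat.lt_or_ge l (k + 1) with hlk | hlk
        · refine ih (by omega) ?_ l (by omega)
          have hks : f (k + 1) ≠ s := fun he => by
            have := hinj (k + 1) 0 (by omega) (by omega) he
            omega
          obtain ⟨v, hv, ⟨-, he⟩ | ⟨he, -⟩⟩ := hTc _ h
          · obtain ⟨m, hm, rfl⟩ := hT hv
            rw [hf, hφ.color_fan_succ k] at he
            rwa [← hlinj m k hm (by omega) he]
          · exact absurd he hks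
        · obtain rfl : l = k + 1 := by omega
          exact h
    obtain ⟨k, hk, rfl⟩ := hT hw
    have h0 : s ∈ T := hdown k hk hw 0 (by omega)
    have hnT : f n ∈ T := by
      obtain ⟨v, hv, ⟨he, -⟩ | ⟨-, he⟩⟩ := hTc _ h0
      · exact absurd rfl he
      · obtain ⟨m, hm, rfl⟩ := hT hv
        rw [← hlinj m n hm le_rfl (he.trans (by rw [hf, ← hφ.color_fan_succ n, ← hf, hn]))]
        exact hv
    refine Set.Subset.antisymm hT ?_
    rintro v ⟨l, hl, rfl⟩
    exact hdown n le_rfl hnT l hl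

/-- A fan that returns to its start is cyclic. -/
theorem IsColoring.exists_isCycle (hφ : IsColoring R φ) (hs : R u s)
    (hne : ∀ k, fan R φ u s k ≠ u) {n : ℕ} (hn : fan R φ u s (n + 1) = s) :
    ∃ Z, IsCycle R φ u Z ∧ s ∈ Z := by
  refine ⟨Set.range (fan R φ u s), ⟨?_, ?_, ?_, ?_⟩, ⟨0, rfl⟩⟩
  · rintro y ⟨k, rfl⟩
    exact hφ.fan_rel hs k
  · rintro y ⟨k, rfl⟩
    exact hne k
  · rintro y ⟨k, rfl⟩
    exact ⟨_, ⟨k + 1, rfl⟩, hφ.color_fan_succ k⟩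
  · rintro T hT ⟨w, hw⟩ hTc
    have hup : ∀ k, fan R φ u s k ∈ T → ∀ i, fan R φ u s (k + i) ∈ T := by
      intro k hk i
      induction i with
      | zero => exact hk
      | succ i ih =>
        obtain ⟨z, hz, he⟩ := hTc _ ih
        obtain ⟨l, rfl⟩ := hT hz
        rw [← add_assoc, hφ.fan_succ_eq (hφ.fan_rel hs l) he]
        exact hz
    have hper : ∀ m, fan R φ u s (m * (n + 1)) = s := by
      intro m
      induction m with
      | zero => simp [fan]
      | succ m ih =>
        have := fan_add (i := m * (n + 1)) (j := 0) (n + 1) ih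
        rwa [zero_add, hn, ← Nat.succ_mul] at this
    obtain ⟨k, rfl⟩ := hT hw
    have h0 : fan R φ u s 0 ∈ T := by
      have := hup k hw (k * n)
      rwa [show k + k * n = k * (n + 1) by ring, hper] at this
    refine Set.Subset.antisymm hT ?_
    rintro v ⟨l, rfl⟩
    have := hup 0 h0 l
    rwa [zero_add] at this

/-- A fan reaches its centre, or returns to its start, or has two vertices with loops of the same
colour. -/
theorem IsColoring.fan_trichotomy [Finite V] (hφ : IsColoring R φ) (u s : V) :
    (∃ k, fan R φ u s k = u) ∨
    ((∀ k, fan R φ u s k ≠ u) ∧ ∃ n, fan R φ u s (n + 1) = s) ∨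
    ((∀ k, fan R φ u s k ≠ u) ∧ ∃ p q, p < q ∧
      φ (fan R φ u s p) (fan R φ u s p) = φ (fan R φ u s q) (fan R φ u s q) ∧
      ∀ i j, i ≤ q → j ≤ q → fan R φ u s i = fan R φ u s j → i = j) := by
  classical
  by_cases h : ∃ k, fan R φ u s k = u
  · exact .inl h
  push Not at h
  refine .inr ?_
  set f := fan R φ u s with hf
  -- The first repetition decides: if it hits index 0 the fan is cyclic; otherwise the two vertices
  -- just before the repeated one have loops of equal colour.
  have hrep : ∃ j, ∃ i < j, f i = f j := by
    obtain ⟨i, j, hij, he⟩ := Finite.exists_ne_map_eq_of_infinite f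
    rcases lt_or_gt_of_ne hij with h | h
    · exact ⟨j, i, h, he⟩
    · exact ⟨i, j, h, he.symm⟩
  obtain ⟨i, hij, he⟩ := Nat.find_spec hrep
  have hmin : ∀ j < Nat.find hrep, ∀ i < j, f i ≠ f j := fun j hj i hi he =>
    Nat.find_min hrep hj ⟨i, hi, he⟩
  obtain ⟨q, hq⟩ := Nat.exists_eq_succ_of_ne_zero (show Nat.find hrep ≠ 0 by omega)
  rw [hq] at he hij hmin
  rcases i with _ | p
  · exact .inl ⟨h, q, he.symm⟩
  · refine .inr ⟨h, p, q, by omega, ?_, ?_⟩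
    · rw [hf, ← hφ.color_fan_succ p, ← hφ.color_fan_succ q, ← hf, he]
    · intro i j hi hj hij'
      rcases lt_trichotomy i j with h | h | h
      · exact absurd hij' (hmin j (by omega) i h)
      · exact h
      · exact absurd hij'.symm (hmin i (by omega) j h)

/-- Swapping the colour of a loop of the fan with the colour of the loop at the centre makes the
fan reach its centre. -/
theorem exists_fan_swapOn_eq (hφ : IsColoring R φ) (hs : R u s) (hD : Closed R φ (φ u u) c D)
    (hu : u ∉ D) {k : ℕ} (hk : fan R φ u s k ∈ D)
    (hkc : φ (fan R φ u s k) (fan R φ u s k) = c) :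
    ∃ l, fan R (swapOn φ (φ u u) c D) u s l = u := by
  set ψ := swapOn φ (φ u u) c D with hψ
  have hψc : IsColoring R ψ := hφ.swapOn hD
  have p1 : ∀ w, ψ u w = φ u w := fun w => by simp [hψ, swapOn, hu]
  by_contra! hcon
  have heq : ∀ j ≤ k, fan R ψ u s j = fan R φ u s j := by
    intro j
    induction j with
    | zero => intro _; rfl
    | succ j ih =>
      intro hj
      have hj' := ih (by omega)
      refine hψc.fan_succ_eq (hφ.fan_rel hs _) ?_
      rw [p1, hφ.color_fan_succ, hj']
      -- The fan would stay at `u` from the next index on, forcing `u ∈ D`.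
      by_cases h0 : φ (fan R φ u s j) (fan R φ u s j) = φ u u
      · exfalso
        have h1 : fan R φ u s (j + 1) = u := hφ.fan_succ_eq (hφ.refl u) h0.symm
        have h2 : ∀ i, fan R φ u s (j + 1 + i) = u := by
          intro i
          induction i with
          | zero => exact h1
          | succ i ih => rw [← add_assoc, fan_succ, ih, hφ.fanNext_self]
        have h3 := h2 (k - (j + 1))
        rw [show j + 1 + (k - (j + 1)) = k by omega] at h3
        exact hu (h3 ▸ hk)
      by_cases hc : φ (fan R φ u s j) (fan R φ u s j) = c
      · by_cases hjD : fan R φ u s j ∈ D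
        · exfalso
          refine hcon (j + 1) (hψc.fan_succ_eq (hφ.refl u) ?_)
          rw [hj', p1]
          simp only [hψ, swapOn]
          grind
        · simp [hψ, swapOn, hjD]
      · simp [hψ, swapOn, h0, hc]
  refine hcon (k + 1) (hψc.fan_succ_eq (hφ.refl u) ?_)
  rw [heq k le_rfl, p1]
  simp only [hψ, swapOn]
  grind

/-! ### Inverting every cyclic fan -/

/-- All unions of cyclic fans with fewer than `n` vertices can be inverted. -/
def InvertibleBelow (K : Type*) (R : V → V → Prop) (n : ℕ) : Prop :=
  ∀ (φ : V → V → K) (u : V) (S : Set V), S.ncard < n → IsColoring R φ → IsBalanced R φ u S →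
    Reach R φ (rot φ u S (φ u u))

theorem IsCycle.congr (h : IsCycle R φ u S) (hs : ∀ y ∈ S, ψ u y = φ u y)
    (hl : ∀ y ∈ S, ψ y y = φ y y) : IsCycle R ψ u S where
  rel := h.rel
  ne := h.ne
  next y hy := by
    obtain ⟨z, hz, he⟩ := h.next y hy
    exact ⟨z, hz, by rw [hs z hz, hl y hy, he]⟩
  min T hT hTn hTc := by
    refine h.min T hT hTn fun y hy => ?_
    obtain ⟨z, hz, he⟩ := hTc y hy
    exact ⟨z, hz, by rw [← hs z (hT hz), ← hl y (hT hy), he]⟩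

/-- To invert a cyclic fan, one may first swap colours away from its centre. -/
theorem IsCycle.reach_of_swapOn (hφ : IsColoring R φ) (h : IsCycle R φ u S)
    (hC : Closed R φ a b C) (hu : u ∉ C) (hl : ∀ y ∈ S, y ∈ C → φ y y ≠ a ∧ φ y y ≠ b)
    (hψ : IsColoring R (swapOn φ a b C) → IsCycle R (swapOn φ a b C) u S →
      Reach R (swapOn φ a b C) (rot (swapOn φ a b C) u S (swapOn φ a b C u u))) :
    Reach R φ (rot φ u S (φ u u)) := by
  refine reach_rot_of_swapOn hφ h.rel h.ne hC hu hl ?_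
  have hsu : ∀ w, swapOn φ a b C u w = φ u w := fun w => by simp [swapOn, hu]
  rw [← hsu u]
  refine hψ (hφ.swapOn hC) (h.congr (fun y _ => hsu y) fun y hy => ?_)
  have := hl y hy
  unfold swapOn
  grind

/-- Whether `u` is connected to the predecessor of `y` decides between passing to a smaller fan and
moving the fan at `y`. -/
theorem IsCycle.reach_of_fan_eq [Finite V] (hT : TriangleFree R)
    (ih : InvertibleBelow K R S.ncard) (hφ : IsColoring R φ)
    (h : IsCycle R φ u S) (hy : y ∈ S) (hf : ∃ k, fan R φ y u k = y) :
    Reach R φ (rot φ u S (φ u u)) := by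
  obtain ⟨z, hz, hzy⟩ := h.prev y hy
  by_cases hn : Conn R φ (φ u y) (φ y y) u z
  · obtain ⟨Z, hZ, hu, ⟨x, hx, hxy⟩, hprev, hmin⟩ :=
      hφ.exists_isPath (hφ.rel_symm (h.rel y hy)) (h.ne y hy).symm hf
    exact h.reach_of_isPath hφ hT hy hz hzy hn hZ hu hx hxy hprev hmin
  · refine h.reach_of_not_conn_prev hφ hy hz hzy hn fun ψ hψ hb => ih ψ u _ ?_ hψ hb
    exact Set.ncard_lt_ncard (Set.sdiff_singleton_ssubset.2 hy)

/-- If `u` and `y` are not connected, the fan is unsaturated. Otherwise their loops fill the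
component, so the one of `w` avoids both; a swap there makes the fan at `y` reach `y` and leaves `S`
a cyclic fan. -/
theorem IsCycle.reach_of_fan_loop_eq [Finite V] (hT : TriangleFree R)
    (ih : InvertibleBelow K R S.ncard) (hφ : IsColoring R φ)
    (h : IsCycle R φ u S) (hy : y ∈ S) {k : ℕ} (hk : fan R φ y u k ≠ u)
    (hkl : φ (fan R φ y u k) (fan R φ y u k) = φ u u) :
    Reach R φ (rot φ u S (φ u u)) := by
  set w := fan R φ y u k with hw
  by_cases hn : Conn R φ (φ u u) (φ y y) u y
  swap
  · exact h.reach_of_not_conn hφ hy hn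
  have hloop := h.loop_ne hφ
  have hyw : y ≠ w := by
    intro he
    exact hloop y hy (by rw [he, hkl])
  obtain ⟨D, hD, huD, hwD⟩ : ∃ D, Closed R φ (φ u u) (φ y y) D ∧ u ∉ D ∧ w ∈ D :=
    exists_closed_of_not_conn hφ ((not_conn_or hφ (h.ne y hy).symm hk.symm hyw (.inl rfl)
      (.inr rfl) (.inl hkl)).resolve_left fun h' => h' hn)
  have hyD : y ∉ D := fun h' => huD (hn.symm hφ D hD h')
  refine h.reach_of_swapOn hφ hD.comm huD ?_ fun hψ hc => hc.reach_of_fan_eq hT ih hψ hy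
    (exists_fan_swapOn_eq hφ (hφ.rel_symm (h.rel y hy)) hD.comm hyD hwD hkl)
  intro x hx hxD
  refine ⟨fun he => hyD (h.inj hφ x hx y hy he ▸ hxD), hloop x hx⟩

/-- One of the two equal loops is not connected to `u` in the colours `φ u u` and `t`. A swap there
should put the colour missing at `u` on a later vertex of the fan at `y`, the previous case; the
difficulty is that the swap may reroute this fan. -/
theorem IsCycle.reach_of_fan_loops_eq [Finite V] (hT : TriangleFree R)
    (ih : InvertibleBelow K R S.ncard) (hφ : IsColoring R φ)
    (h : IsCycle R φ u S) (hy : y ∈ S) {p q : ℕ} (hpq : p < q)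
    (hl : φ (fan R φ y u p) (fan R φ y u p) = φ (fan R φ y u q) (fan R φ y u q))
    (hinj : ∀ i j, i ≤ q → j ≤ q → fan R φ y u i = fan R φ y u j → i = j) :
    Reach R φ (rot φ u S (φ u u)) := by
  have hyu := hφ.rel_symm (h.rel y hy)
  set f := fan R φ y u with hf
  by_cases hreach : ∃ k, f k = y
  · exact h.reach_of_fan_eq hT ih hφ hy hreach
  by_cases hloop : ∃ k, f k ≠ u ∧ φ (f k) (f k) = φ u u
  · obtain ⟨k, hk, hkl⟩ := hloop
    exact h.reach_of_fan_loop_eq hT ih hφ hy hk hkl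
  push Not at hreach hloop
  have hf0 : ∀ j ≤ q, j ≠ 0 → f j ≠ u := fun j hj hj0 he => hj0 (hinj j 0 hj (by omega) he)
  have hcol : ∀ j, φ y (f (j + 1)) = φ (f j) (f j) := hφ.color_fan_succ
  have hrel : ∀ j, R y (f j) := hφ.fan_rel hyu
  set t := φ (f p) (f p) with ht
  have ht0 : t ≠ φ u u := by
    rw [hl]
    exact hloop q (hf0 q le_rfl (by omega))
  have hp0 : p ≠ 0 := by
    rintro rfl
    exact ht0 rfl
  have huy : u ≠ y := (h.ne y hy).symm
  obtain ⟨D, hD, huD, hpqD⟩ : ∃ D, Closed R φ (φ u u) t D ∧ u ∉ D ∧ (f p ∈ D ∨ f q ∈ D) := by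
    rcases not_conn_or hφ (a := φ u u) (b := t) (hf0 p (by omega) hp0).symm
      (hf0 q le_rfl (by omega)).symm (fun he => by have := hinj p q (by omega) le_rfl he; omega)
      (.inl rfl) (.inr rfl) (.inr hl.symm) with h' | h'
    · obtain ⟨D, h1, h2, h3⟩ := exists_closed_of_not_conn hφ h'
      exact ⟨D, h1, h2, .inl h3⟩
    · obtain ⟨D, h1, h2, h3⟩ := exists_closed_of_not_conn hφ h'
      exact ⟨D, h1, h2, .inr h3⟩
  -- A vertex of `S` that the swap would spoil is itself not connected to `u`, so `S` is unsaturated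
  -- there.
  by_cases hSD : ∃ x ∈ S, φ x x = t ∧ x ∈ D
  · obtain ⟨x, hx, hxt, hxD⟩ := hSD
    refine h.reach_of_not_conn hφ hx fun hcon => huD ?_
    rw [hxt] at hcon
    exact hcon.symm hφ D hD hxD
  push Not at hSD
  refine h.reach_of_swapOn hφ hD huD
    (fun x hx hxD => ⟨h.loop_ne hφ x hx, fun he => hSD x hx he hxD⟩) fun hψ hc => ?_
  set ψ := swapOn φ (φ u u) t D with hψd
  have hψu : ψ u u = φ u u := by simp [hψd, swapOn, huD]
  suffices hgoal : ∃ k, fan R ψ y u k ≠ u ∧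
      ψ (fan R ψ y u k) (fan R ψ y u k) = φ u u by
    obtain ⟨k, hk, hkl⟩ := hgoal
    exact hc.reach_of_fan_loop_eq hT ih hψ hy hk (hkl.trans hψu.symm)
  by_contra! hcon
  -- a vertex of the fan in `D` with loop colour `t` gets the loop colour that is missing at `u`
  have hlt : ∀ v ∈ D, φ v v = t → ψ v v = φ u u := by
    intro v hv hvt
    simp only [hψd, swapOn]
    grind
  have hlD : ∀ v, v ∉ D → ψ v v = φ v v := by
    intro v hv
    simp [hψd, swapOn, hv]
  have hle : ∀ v, φ v v ≠ φ u u → φ v v ≠ t → ψ v v = φ v v := by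
    intro v h1 h2
    simp [hψd, swapOn, h1, h2]
  let O : Set V := Set.range (fan R ψ y u)
  have hO0 : u ∈ O := ⟨0, rfl⟩
  have hOD : ∀ v ∈ O, v ≠ u → φ v v = t → v ∉ D := by
    rintro v ⟨k, rfl⟩ hvu hvt hvD
    exact hcon k hvu (hlt _ hvD hvt)
  have hOs : ∀ v ∈ O, ∀ w, R y w → ψ y w = ψ v v → w ∈ O := by
    rintro v ⟨k, rfl⟩ w hw he
    exact ⟨k + 1, hψ.fan_succ_eq hw he⟩
  have hfp : ∀ j ≤ q, j ≠ 0 → φ (f j) (f j) ≠ φ u u := fun j hj hj0 => hloop j (hf0 j hj hj0)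
  have hft : ∀ j < q, φ (f j) (f j) = t → j = p := by
    intro j hj he
    have h1 : f (j + 1) = f (p + 1) := hφ.inj (hrel _) (hrel _) (by rw [hcol, hcol, he])
    have := hinj (j + 1) (p + 1) (by omega) (by omega) h1
    omega
  -- If `y ∈ D`, the colours of the edges from `y` to `f 1` and `f (p + 1)` are exchanged. The new
  -- fan runs from `u` to `f (p + 1)` and on to `f q`; if `f q ∉ D`, it continues with `f 1` up to
  -- `f p`, which then lies in `D`.
  by_cases hyD : y ∈ D
  · have hs0 : ∀ w, φ y w = φ u u → ψ y w = t := by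
      intro w hw
      simp only [hψd, swapOn]
      grind
    have hst : ∀ w, φ y w = t → ψ y w = φ u u := by
      intro w hw
      simp only [hψd, swapOn]
      grind
    have hse : ∀ w, φ y w ≠ φ u u → φ y w ≠ t → ψ y w = φ y w := by
      intro w h1 h2
      simp [hψd, swapOn, h1, h2]
    have hstep : ∀ j ≤ q, j < q → j ≠ 0 → j ≠ p → f j ∈ O → f (j + 1) ∈ O := by
      intro j _ hj hj0 hjp hjO
      have h1 := hfp j hj.le hj0
      have h2 : φ (f j) (f j) ≠ t := fun he => hjp (hft j hj he)
      refine hOs _ hjO _ (hrel _) ?_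
      rw [hle _ h1 h2, hse _ (by rwa [hcol]) (by rwa [hcol]), hcol]
    have hup : ∀ i, p + 1 + i ≤ q → f (p + 1 + i) ∈ O := by
      intro i
      induction i with
      | zero =>
        intro _
        exact hOs u hO0 _ (hrel _) (by rw [hst _ (hcol p), hψu])
      | succ i ih' =>
        intro hi
        exact hstep (p + 1 + i) (by omega) (by omega) (by omega) (by omega) (ih' (by omega))
    have hqO : f q ∈ O := by
      have := hup (q - (p + 1)) (by omega)
      rwa [show p + 1 + (q - (p + 1)) = q by omega] at this
    have hqD : f q ∉ D := hOD _ hqO (hf0 q le_rfl (by omega)) hl.symm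
    have h1O : f 1 ∈ O := hOs _ hqO _ (hrel _) (by rw [hs0 _ (hcol 0), hlD _ hqD, ← hl])
    have hlow : ∀ i, 1 + i ≤ p → f (1 + i) ∈ O := by
      intro i
      induction i with
      | zero => exact fun _ => h1O
      | succ i ih' =>
        intro hi
        exact hstep (1 + i) (by omega) (by omega) (by omega) (by omega) (ih' (by omega))
    have hpO : f p ∈ O := by
      have := hlow (p - 1) (by omega)
      rwa [show 1 + (p - 1) = p by omega] at this
    exact hpqD.elim (hOD _ hpO (hf0 p (by omega) hp0) rfl) hqD
  -- The edges at `y` are untouched, so the old fan is followed up to its first vertex in `D` with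
  -- loop colour `t`.
  · have hse : ∀ w, ψ y w = φ y w := fun w => by simp [hψd, swapOn, hyD]
    have hO : ∀ j ≤ q, f j ∈ O := by
      intro j
      induction j with
      | zero => exact fun _ => hO0
      | succ j ih' =>
        intro hj
        have hjO := ih' (by omega)
        refine hOs _ hjO _ (hrel _) ?_
        rw [hse, hcol]
        by_cases hj0 : j = 0
        · subst hj0
          exact hψu.symm
        by_cases hjt : φ (f j) (f j) = t
        · exact (hlD _ (hOD _ hjO (hf0 j (by omega) hj0) hjt)).symm
        · exact (hle _ (hfp j (by omega) hj0) hjt).symm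
    exact hpqD.elim (hOD _ (hO p hpq.le) (hf0 p (by omega) hp0) rfl)
      (hOD _ (hO q le_rfl) (hf0 q le_rfl (by omega)) hl.symm)

/-- The case distinction is on the fan at `y` that starts at `u`. If it is cyclic, the loops at `y`,
at its predecessor `z` and at the predecessor `x` of `u` compete for one component; when `y` and `z`
are connected, `x` is not, so the fan at `y` is unsaturated and can be inverted first. -/
theorem IsCycle.reach_rot [Finite V] (hT : TriangleFree R)
    (ih : InvertibleBelow K R S.ncard) (hφ : IsColoring R φ) (h : IsCycle R φ u S) (hy : y ∈ S) :
    Reach R φ (rot φ u S (φ u u)) := by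
  have huy := h.rel y hy
  have hyu := hφ.rel_symm huy
  have hyne := h.ne y hy
  rcases hφ.fan_trichotomy y u with hf | ⟨hne, n, hn⟩ | ⟨-, p, q, hpq, hl, hinj⟩
  · exact h.reach_of_fan_eq hT ih hφ hy hf
  · obtain ⟨z, hz, hzy⟩ := h.prev y hy
    by_cases hc : Conn R φ (φ u y) (φ y y) u z
    swap
    · refine h.reach_of_not_conn_prev hφ hy hz hzy hc fun ψ hψ hb => ih ψ u _ ?_ hψ hb
      exact Set.ncard_lt_ncard (Set.sdiff_singleton_ssubset.2 hy)
    obtain ⟨Z, hZ, hu⟩ := hφ.exists_isCycle hyu hne hn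
    refine h.reach_of_isCycle hφ hT hy hZ hu ?_
    obtain ⟨x, hx, hxu⟩ := hZ.prev u hu
    rw [← hφ.symm huy] at hxu
    have hxne : x ≠ u := by
      rintro rfl
      exact h.spoke_ne hφ y hy hxu.symm
    have hyz : y ≠ z := by
      rintro rfl
      exact hyne (hφ.inj (hφ.refl _) hyu (hzy.trans (hφ.symm huy)))
    have hzx : z ≠ x := by
      rintro rfl
      exact hT.disjoint hyne huy (fun x hx => ⟨h.rel x hx, h.ne x hx⟩)
        (fun x hx => ⟨hZ.rel x hx, hZ.ne x hx⟩) z hx hz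
    refine hZ.reach_of_not_conn hφ hx fun hcon => ?_
    rw [hxu] at hcon
    rcases not_conn_or hφ (a := φ u y) (b := φ y y) hyz (hZ.ne x hx).symm hzx (.inr rfl)
      (.inl hzy) (.inl hxu) with h' | h'
    · exact h' fun C hC hyC => hc C hC (hC hyu (.inl (hφ.symm huy).symm) hyC)
    · exact h' hcon.comm
  · exact h.reach_of_fan_loops_eq hT ih hφ hy hpq hl hinj

/-- In a triangle-free graph, all cyclic fans can be inverted. -/
theorem IsBalanced.reach_rot [Finite V] (hT : TriangleFree R) (hφ : IsColoring R φ)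
    (h : IsBalanced R φ u S) : Reach R φ (rot φ u S (φ u u)) := by
  induction hn : S.ncard using Nat.strong_induction_on generalizing φ u S with
  | _ n ih =>
  have ih' : InvertibleBelow K R S.ncard := fun φ u T hlt hφ hb => ih _ (hn ▸ hlt) hφ hb rfl
  rcases S.eq_empty_or_nonempty with rfl | ⟨y, hy⟩
  · have : Nonempty K := ⟨φ u u⟩
    refine reach_of_agree fun v w _ => ?_
    unfold rot
    grind
  -- A non-minimal union splits into `T` and `S \ T`, which are inverted one after the other.
  by_cases hc : ∀ T ⊆ S, T.Nonempty → (∀ y ∈ T, ∃ z ∈ T, φ u z = φ y y) → T = S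
  · exact IsCycle.reach_rot hT ih' hφ ⟨h.rel, h.ne, h.next, hc⟩ hy
  push Not at hc
  obtain ⟨T, hTS, hTn, hTc, hne⟩ := hc
  have hTb : IsBalanced R φ u T := ⟨fun y hy => h.rel y (hTS hy), fun y hy => h.ne y (hTS hy),
    fun y hy z hz => h.inj y (hTS hy) z (hTS hz), hTc⟩
  have h1 := ih' φ u T (Set.ncard_lt_ncard (hTS.ssubset_of_ne hne)) hφ hTb
  set ψ := rot φ u T (φ u u) with hψ
  have hψc := hφ.reach h1
  have hl : ∀ x ∈ S \ T, ψ x x = φ x x := fun x hx => by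
    rw [hψ, rot_of_notMem hx.2 (h.ne x hx.1)]
  have hs : ∀ x ∈ S \ T, ψ u x = φ u x := fun x hx => by
    rw [hψ, rot_spoke_of_notMem hx.2 (h.ne x hx.1)]
  have hψu : ψ u u = φ u u := by rw [hψ, rot_self]
  have hb : IsBalanced R ψ u (S \ T) := by
    refine ⟨fun y hy => h.rel y hy.1, fun y hy => h.ne y hy.1, ?_, ?_⟩
    · intro x hx x' hx' he
      rw [hl x hx, hl x' hx'] at he
      exact h.inj x hx.1 x' hx'.1 he
    · intro x hx
      obtain ⟨z, hz, he⟩ := h.next x hx.1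
      have hzT : z ∉ T := fun hzT => by
        obtain ⟨x', hx', he'⟩ := hTb.prev z hzT
        exact hx.2 (h.inj x' (hTS hx') x hx.1 (he'.trans he) ▸ hx')
      exact ⟨z, ⟨hz, hzT⟩, by rw [hl x hx, hs z ⟨hz, hzT⟩, he]⟩
  obtain ⟨t, ht⟩ := hTn
  have h2 := ih' ψ u (S \ T) (Set.ncard_lt_ncard
    ⟨Set.sdiff_subset, fun hsub => (hsub (hTS ht)).2 ht⟩) hψc hb
  rw [hψu] at h2
  refine (h1.trans h2).congr fun v w _ => ?_
  have mem : ∀ x, x ∈ S \ T ↔ x ∈ S ∧ x ∉ T := fun x => Iff.rfl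
  have hsub : ∀ x ∈ T, x ∈ S := hTS
  have e1 := rot_cases φ (φ u u) h.ne v w
  have e2 := rot_cases φ (φ u u) hTb.ne v w
  have hlv := hl v
  have hlw := hl w
  have hsv := hs v
  rw [← hψ] at e2
  rcases rot_cases ψ (φ u u) hb.ne v w with ⟨h1, h2, h3⟩ | ⟨h1, h2, h3, h4⟩ |
      ⟨h1, h2, h3, h4⟩ | ⟨h1, h2, h3, h4⟩ | ⟨h1, h2⟩
  · grind
  · grind
  · grind
  · grind
  · rw [mem, mem] at h1
    rw [h2]
    clear hψ hψc hψu
    have := hsub v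
    have := hsub w
    grind

/-! ### Making a perfect matching monochromatic -/

theorem exists_reach_loop_eq_of_fan_eq [Finite V] (hφ : IsColoring R φ) (hy : R u y) (hne : y ≠ u)
    (h : ∃ k, fan R φ u y k = u) :
    ∃ ψ, Reach R φ ψ ∧ ψ y y = φ u y ∧ ∀ v w, R v w → φ v w = φ u y → ¬ (v = u ∧ w = y) →
      ¬ (v = y ∧ w = u) → (v = w → ¬ R u v) → ψ v w = φ u y := by
  obtain ⟨Z, hZ, hyZ, -⟩ := hφ.exists_isPath hy hne h
  refine ⟨_, hZ.reach hφ, rot_loop hyZ hne, ?_⟩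
  intro v w hvw hc h1 h2 h3
  have h4 := @hφ.inj u w y
  have h5 := @hφ.inj u v y
  have h6 := hφ.symm hvw
  have h7 := hφ.rel_symm hvw
  have h8 := hZ.rel v
  rcases rot_cases φ (φ u y) hZ.ne v w with ⟨h1, h2, h3⟩ | ⟨h1, h2, h3, h4⟩ |
      ⟨h1, h2, h3, h4⟩ | ⟨h1, h2, h3, h4⟩ | ⟨h1, h2⟩ <;> grind

/-- The colour of the edge `uy` can be made missing at `y`, while the other edges of this colour
keep it, and it stays missing wherever it is, except perhaps at one neighbour of `u`. -/
theorem exists_reach_loop_eq [Finite V] (hT : TriangleFree R) (hφ : IsColoring R φ) (hy : R u y)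
    (hne : y ≠ u) :
    ∃ ψ, Reach R φ ψ ∧ ψ y y = φ u y ∧ ∀ v w, R v w → φ v w = φ u y → ¬ (v = u ∧ w = y) →
      ¬ (v = y ∧ w = u) → (v = w → ¬ R u v) → ψ v w = φ u y := by
  have hcu : φ u u ≠ φ u y := fun he => hne (hφ.inj (hφ.refl u) hy he).symm
  rcases hφ.fan_trichotomy u y with hf | ⟨hnu, n, hn⟩ | ⟨hnu, p, q, hpq, hl, hinj⟩
  · exact exists_reach_loop_eq_of_fan_eq hφ hy hne hf
  · obtain ⟨Z, hZ, hyZ⟩ := hφ.exists_isCycle hy hnu hn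
    refine ⟨_, (hZ.isBalanced hφ).reach_rot hT hφ, rot_loop hyZ hne, ?_⟩
    intro v w hvw hc h1 h2 h3
    have h4 := @hφ.inj u w y
    have h5 := @hφ.inj u v y
    have h6 := hφ.symm hvw
    have h7 := hφ.rel_symm hvw
    have h8 := hZ.rel v
    rcases rot_cases φ (φ u u) hZ.ne v w with ⟨h1, h2, h3⟩ | ⟨h1, h2, h3, h4⟩ |
        ⟨h1, h2, h3, h4⟩ | ⟨h1, h2, h3, h4⟩ | ⟨h1, h2⟩ <;> grind
  · set f := fan R φ u y with hf
    set t := φ (f p) (f p) with ht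
    have htc : t ≠ φ u y := by
      intro he
      have h1 : f (p + 1) = f 0 := hφ.fan_succ_eq hy he.symm
      have := hinj (p + 1) 0 (by omega) (by omega) h1
      omega
    -- Of the two fan vertices with loop colour `t`, one is not connected to `u`; swapping there
    -- makes the fan reach `u`. The colour of `uy` is neither `φ u u` nor `t`, so this swap leaves
    -- it alone.
    obtain ⟨D, hD, huD, k, hkD, hkt⟩ : ∃ D, Closed R φ (φ u u) t D ∧ u ∉ D ∧
        ∃ k, f k ∈ D ∧ φ (f k) (f k) = t := by
      rcases not_conn_or hφ (a := φ u u) (b := t) (hnu p).symm (hnu q).symm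
        (fun he => by have := hinj p q (by omega) le_rfl he; omega) (.inl rfl) (.inr rfl)
        (.inr hl.symm) with h' | h'
      · obtain ⟨D, h1, h2, h3⟩ := exists_closed_of_not_conn hφ h'
        exact ⟨D, h1, h2, p, h3, rfl⟩
      · obtain ⟨D, h1, h2, h3⟩ := exists_closed_of_not_conn hφ h'
        exact ⟨D, h1, h2, q, h3, hl.symm⟩
    have hreach := exists_fan_swapOn_eq hφ hy hD huD hkD hkt
    set χ := swapOn φ (φ u u) t D with hχ
    have h1 : Reach R φ χ := hD.reach fun _ _ _ => rfl
    have hχy : χ u y = φ u y := by simp [hχ, swapOn, huD]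
    obtain ⟨ψ, h2, h3, h4⟩ := exists_reach_loop_eq_of_fan_eq (hφ.reach h1) hy hne hreach
    rw [hχy] at h3 h4
    refine ⟨ψ, h1.trans h2, h3, fun v w hvw hc => h4 v w hvw ?_⟩
    simp only [hχ, swapOn]
    grind

/-- A perfect matching can be made monochromatic. -/
theorem exists_reach_matching [Finite V] (hT : TriangleFree R) (hφ : IsColoring R φ) (c : K)
    {μ : V → V} (hμ : ∀ v, R v (μ v)) (hμne : ∀ v, μ v ≠ v) (hμμ : ∀ v, μ (μ v) = v) :
    ∃ ψ, Reach R φ ψ ∧ ∀ v, ψ v (μ v) = c := by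
  have hfree : ∀ φ : V → V → K, IsColoring R φ → ∀ v, φ v (μ v) ≠ c →
      ∃ ψ, Reach R φ ψ ∧ ψ v v = c ∧ (∀ x, φ x (μ x) = c → ψ x (μ x) = c) ∧
        (φ (μ v) (μ v) = c → ψ (μ v) (μ v) = c) := by
    intro φ hφ v hv
    by_cases hvv : φ v v = c
    · exact ⟨φ, .refl, hvv, fun _ h => h, fun h => h⟩
    obtain ⟨u, hu, huc⟩ := hφ.surj v c
    have huv : v ≠ u := by
      rintro rfl
      exact hvv huc
    have huμ : u ≠ μ v := by
      rintro rfl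
      exact hv huc
    have hu' := hφ.rel_symm hu
    have hcu : φ u v = c := by rw [hφ.symm hu', huc]
    obtain ⟨ψ, h1, h2, h3⟩ := exists_reach_loop_eq hT hφ hu' huv
    rw [hcu] at h2 h3
    refine ⟨ψ, h1, h2, fun x hx => ?_, fun hl => ?_⟩
    · refine h3 x (μ x) (hμ x) hx ?_ ?_ fun he => absurd he.symm (hμne x)
      · rintro ⟨rfl, he⟩
        exact huμ (by rw [← he, hμμ])
      · rintro ⟨rfl, he⟩
        exact huμ he.symm
    · refine h3 (μ v) (μ v) (hφ.refl _) hl (fun h => hμne v h.2) (fun h => hμne v h.1) ?_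
      -- The only loops of colour `c` that may be lost are at neighbours of `u`; as `u` is adjacent
      -- to `v`, triangle-freeness excludes `μ v`.
      intro _ hr
      rcases hT u v (μ v) hu' (hμ v) hr with h | h | h
      · exact huv h.symm
      · exact hμne v h.symm
      · exact huμ h
  induction hn : {v | φ v (μ v) ≠ c}.ncard using Nat.strong_induction_on generalizing φ with
  | _ n ih =>
  by_cases hall : ∀ v, φ v (μ v) = c
  · exact ⟨φ, .refl, hall⟩
  push Not at hall
  obtain ⟨v, hv⟩ := hall
  obtain ⟨ψ, h1, hψv, hψg, -⟩ := hfree φ hφ v hv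
  have hψc := hφ.reach h1
  have hv' : ψ (μ v) (μ (μ v)) ≠ c := by
    rw [hμμ, ← hψc.symm (hμ v)]
    intro he
    exact hμne v (hψc.inj (hμ v) (hψc.refl v) (he.trans hψv.symm))
  obtain ⟨χ, h2, hχw, hχg, hχv⟩ := hfree ψ hψc (μ v) hv'
  rw [hμμ] at hχv
  have hχv := hχv hψv
  have hχc := hψc.reach h2
  set w := μ v with hw
  have hvw : R v w := hμ v
  have hwv := hχc.rel_symm hvw
  have hne : w ≠ v := hμne v
  -- With `c` missing at both ends, the edge `vw` is a component by itself and can be given the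
  -- colour `c`.
  have hcl : Closed R χ c (χ v w) {v, w} := by
    intro x x' hx hc hxv
    have e1 := @hχc.inj v x' v
    have e2 := @hχc.inj v x' w
    have e3 := @hχc.inj w x' v
    have e4 := @hχc.inj w x' w
    have e5 := hχc.symm hvw
    have e6 := hχc.refl v
    have e7 := hχc.refl w
    simp only [Set.mem_insert_iff, Set.mem_singleton_iff] at hxv ⊢
    grind
  set ω := swapOn χ c (χ v w) {v, w} with hω
  have h3 : Reach R χ ω := hcl.reach fun _ _ _ => rfl
  have hωc := hχc.reach h3
  have hωv : ω v w = c := by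
    simp only [hω, swapOn, Set.mem_insert_iff, Set.mem_singleton_iff]
    grind
  have hωg : ∀ x, φ x (μ x) = c → ω x (μ x) = c := by
    intro x hx
    have hx' := hχg x (hψg x hx)
    have h4 : x ≠ v := by
      intro he
      rw [he] at hx
      exact hv hx
    have h5 : x ≠ w := by
      intro he
      rw [he, hw, hμμ, ← hφ.symm (hμ v)] at hx
      exact hv hx
    simp [hω, swapOn, h4, h5, hx']
  obtain ⟨θ, h4, h5⟩ := ih _ (hn ▸ Set.ncard_lt_ncard ⟨fun x hx hc => hx (hωg x hc),
    fun hsub => hsub hv hωv⟩) hωc rfl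
  exact ⟨θ, h1.trans (h2.trans (h3.trans h4)), h5⟩

/-! ### Deleting a colour class and induction on the number of colours -/

open Classical in
/-- Extend a colouring without the colour `c` by a matching of this colour. -/
noncomputable def extend (μ : V → V) (c : K) (φ : V → V → {x : K // x ≠ c}) (v w : V) : K :=
  if w = μ v then c else φ v w

theorem extend_of_eq {μ : V → V} {φ : V → V → {x : K // x ≠ c}} (h : w = μ v) :
    extend μ c φ v w = c := if_pos h

theorem extend_of_ne {μ : V → V} {φ : V → V → {x : K // x ≠ c}} (h : w ≠ μ v) :
    extend μ c φ v w = φ v w := if_neg h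

/-- The swaps use only colours other than `c`, so the same closed sets serve after the matching is
added and the matching is never recoloured. -/
theorem Reach.extend {μ : V → V} {φ ψ : V → V → {x : K // x ≠ c}}
    (h : Reach (fun v w => R v w ∧ w ≠ μ v) φ ψ) :
    Reach R (extend μ c φ) (extend μ c ψ) := by
  induction h with
  | refl => exact .refl
  | @tail φ' ψ' _ h ih =>
    refine ih.trans ?_
    obtain ⟨a, b, C, hC, h⟩ := h
    have ha := a.2
    have hb := b.2
    refine Closed.reach (a := a.1) (b := b.1) (C := C) ?_ ?_
    · intro v w hvw hc hv
      by_cases hw : w = μ v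
      · rw [extend_of_eq hw] at hc
        exact hc.elim (fun h => absurd h.symm ha) fun h => absurd h.symm hb
      · rw [extend_of_ne hw] at hc
        exact hC ⟨hvw, hw⟩ (hc.imp Subtype.ext Subtype.ext) hv
    · intro v w hvw
      unfold swapOn
      by_cases hw : w = μ v
      · rw [extend_of_eq hw, extend_of_eq hw, if_neg ha.symm, if_neg hb.symm, ite_self]
      · rw [extend_of_ne hw, extend_of_ne hw, h v w ⟨hvw, hw⟩, swapOn]
        have e1 := @Subtype.ext_iff _ _ (φ' v w) a
        have e2 := @Subtype.ext_iff _ _ (φ' v w) b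
        split_ifs <;> grind

open Classical in
/-- Forget the colour `c`. -/
noncomputable def forget (d : {x : K // x ≠ c}) (φ : V → V → K) (v w : V) : {x : K // x ≠ c} :=
  if h : φ v w ≠ c then ⟨φ v w, h⟩ else d

theorem IsColoring.ne_of_matching {μ : V → V} (hφ : IsColoring R φ) (hμ : ∀ v, R v (μ v))
    (hc : ∀ v, φ v (μ v) = c) (hvw : R v w ∧ w ≠ μ v) : φ v w ≠ c :=
  fun he => hvw.2 (hφ.inj hvw.1 (hμ v) (he.trans (hc v).symm))

theorem IsColoring.forget {μ : V → V} (hφ : IsColoring R φ) (hμ : ∀ v, R v (μ v))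
    (hμne : ∀ v, μ v ≠ v) (hμμ : ∀ v, μ (μ v) = v) (hc : ∀ v, φ v (μ v) = c)
    (d : {x : K // x ≠ c}) :
    IsColoring (fun v w => R v w ∧ w ≠ μ v) (forget d φ) := by
  have key : ∀ {v w}, R v w ∧ w ≠ μ v → (LoopedColoring.forget d φ v w).1 = φ v w := by
    intro v w hvw
    simp [LoopedColoring.forget, hφ.ne_of_matching hμ hc hvw]
  have hrs : ∀ {v w}, R v w ∧ w ≠ μ v → R w v ∧ v ≠ μ w := fun {v w} h =>
    ⟨hφ.rel_symm h.1, fun he => h.2 (by rw [he, hμμ])⟩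
  refine ⟨fun v => ⟨hφ.refl v, (hμne v).symm⟩, hrs, ?_, ?_, ?_⟩
  · intro v w hvw
    exact Subtype.ext (by rw [key hvw, key (hrs hvw), hφ.symm hvw.1])
  · intro v w w' hw hw' he
    have := congrArg Subtype.val he
    rw [key hw, key hw'] at this
    exact hφ.inj hw.1 hw'.1 this
  · rintro v ⟨e, he⟩
    obtain ⟨w, hw, hwe⟩ := hφ.surj v e
    have hvw : R v w ∧ w ≠ μ v := ⟨hw, fun h' => he (by rw [← hwe, h', hc])⟩
    exact ⟨w, hvw, Subtype.ext (by rw [key hvw, hwe])⟩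

theorem extend_forget {μ : V → V} (hφ : IsColoring R φ) (hμ : ∀ v, R v (μ v))
    (hc : ∀ v, φ v (μ v) = c) (d : {x : K // x ≠ c}) (hvw : R v w) :
    extend μ c (forget d φ) v w = φ v w := by
  unfold extend
  split_ifs with h
  · rw [h, hc]
  · simp [forget, hφ.ne_of_matching hμ hc ⟨hvw, h⟩]

/-- In a triangle-free graph, a colouring in which some colour is missing everywhere can be reached
from every colouring. -/
theorem reach_of_loops_eq [Finite V] [Finite K] (hT : TriangleFree R) (hφ : IsColoring R φ)
    (hψ : IsColoring R ψ) (hd : ∀ v, ψ v v = d) : Reach R φ ψ := by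
  induction hn : Nat.card K generalizing K R with
  | zero =>
    have := Finite.card_eq_zero_iff.1 hn
    exact isEmptyElim d
  | succ n ih =>
    -- A colour `c ≠ d` is on no loop of `ψ`, so its class is a perfect matching `μ`.
    by_cases hall : ∀ c, c = d
    · have : Nonempty K := ⟨d⟩
      exact reach_of_agree fun v w _ => (hall _).trans (hall _).symm
    push Not at hall
    obtain ⟨c, hcd⟩ := hall
    choose μ hμ hμc using fun v => hψ.surj v c
    have hμne : ∀ v, μ v ≠ v := by
      intro v he
      have := hμc v
      rw [he, hd] at this
      exact hcd this.symm
    have hμμ : ∀ v, μ (μ v) = v := by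
      intro v
      refine hψ.inj (hμ _) (hψ.rel_symm (hμ v)) ?_
      rw [hμc, ← hψ.symm (hμ v), hμc]
    obtain ⟨χ, h1, hχμ⟩ := exists_reach_matching hT hφ c hμ hμne hμμ
    have hχ := hφ.reach h1
    let e : {x : K // x ≠ c} := ⟨d, hcd.symm⟩
    have h2 : Reach (fun v w => R v w ∧ w ≠ μ v) (forget e χ) (forget e ψ) := by
      refine ih (d := e) (fun x y z h h' h'' => hT x y z h.1 h'.1 h''.1)
        (hχ.forget hμ hμne hμμ hχμ e) (hψ.forget hμ hμne hμμ hμc e) (fun v => ?_) ?_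
      · simp [forget, hd, hcd.symm, e]
      · have := Fintype.ofFinite K
        classical
        rw [Nat.card_eq_fintype_card] at hn ⊢
        rw [Fintype.card_subtype_compl, hn, Fintype.card_subtype_eq]
        rfl
    have h3 : Reach R χ (extend μ c (forget e χ)) := by
      have : Nonempty K := ⟨d⟩
      exact reach_of_agree fun v w hvw => extend_forget hχ hμ hχμ e hvw
    exact h1.trans (h3.trans (h2.extend.congr fun v w hvw => (extend_forget hψ hμ hμc e hvw).symm))

end LoopedColoring

/-! ### From swaps on closed sets to Kempe changes -/

namespace SimpleGraph.EdgeColoring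

variable {V K : Type*} {G : SimpleGraph V} {a b : K}

open Classical in
theorem kempeSwap_apply (α : G.EdgeColoring K) (D : (α.bicoloured a b).ConnectedComponent)
    {v w : V} (h : G.Adj v w) :
    α.kempeSwap a b D ⟨s(v, w), h⟩ =
      if v ∈ D.supp then Equiv.swap a b (α ⟨s(v, w), h⟩) else α ⟨s(v, w), h⟩ := by
  have key : α.kempeSwap a b D ⟨s(v, w), h⟩ = if ∃ x ∈ D.supp, x ∈ s(v, w) then
      Equiv.swap a b (α ⟨s(v, w), h⟩) else α ⟨s(v, w), h⟩ := rfl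
  rw [key]
  by_cases hv : v ∈ D.supp
  · rw [if_pos hv, if_pos ⟨v, hv, Sym2.mem_mk_left v w⟩]
  · rw [if_neg hv]
    split_ifs with hx
    · obtain ⟨x, hx, hxe⟩ := hx
      have hn : ¬ (α ⟨s(v, w), h⟩ = a ∨ α ⟨s(v, w), h⟩ = b) := fun hc =>
        hv (α.mem_supp_of_mem D ⟨s(v, w), h⟩ hc hxe (Sym2.mem_mk_left v w) hx)
      push Not at hn
      exact Equiv.swap_apply_of_ne_of_ne hn.1 hn.2
    · rfl

open Classical in
/-- The colours `a` and `b` can be exchanged on any union of components. -/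
theorem exists_kempeReachable_swap [Finite V] (hab : a ≠ b) (α : G.EdgeColoring K) (C : Set V)
    (hC : ∀ v w (h : G.Adj v w), α ⟨s(v, w), h⟩ = a ∨ α ⟨s(v, w), h⟩ = b → v ∈ C → w ∈ C) :
    ∃ β : G.EdgeColoring K, α.KempeReachable β ∧ ∀ v w (h : G.Adj v w), β ⟨s(v, w), h⟩ =
      if v ∈ C then Equiv.swap a b (α ⟨s(v, w), h⟩) else α ⟨s(v, w), h⟩ := by
  induction hn : C.ncard using Nat.strong_induction_on generalizing α C with
  | _ n ih =>
  obtain rfl | ⟨v₀, hv₀⟩ := C.eq_empty_or_nonempty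
  · exact ⟨α, .refl, by simp⟩
  set D := (α.bicoloured a b).connectedComponentMk v₀ with hD
  have hv₀D : v₀ ∈ D.supp := rfl
  have hDC : D.supp ⊆ C := by
    intro v hv
    obtain ⟨p⟩ := ConnectedComponent.exact hv
    have : ∀ {x y : V}, (α.bicoloured a b).Walk x y → y ∈ C → x ∈ C := by
      intro x y p
      induction p with
      | nil => exact id
      | cons hxy _ ihp =>
        intro hy
        obtain ⟨h, hc⟩ := (α.bicoloured_adj a b _ _).1 hxy.symm
        exact hC _ _ h hc (ihp hy)
    exact this p hv₀
  have hcol : ∀ c : K, (Equiv.swap a b c = a ∨ Equiv.swap a b c = b) → c = a ∨ c = b := by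
    intro c
    rw [Equiv.swap_apply_def]
    split_ifs <;> simp_all
  obtain ⟨β, hβ, hβe⟩ := ih (C \ D.supp).ncard
    (hn ▸ Set.ncard_lt_ncard ⟨Set.sdiff_subset, fun h => (h hv₀).2 hv₀D⟩)
    (α.kempeSwap a b D) (C \ D.supp) (by
      intro v w h hc hv
      rw [kempeSwap_apply, if_neg hv.2] at hc
      exact ⟨hC v w h hc hv.1, fun hw => hv.2 (α.mem_supp_of_mem D ⟨s(v, w), h⟩ hc
        (Sym2.mem_mk_right v w) (Sym2.mem_mk_left v w) hw)⟩) rfl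
  refine ⟨β, .head ⟨a, b, hab, D, rfl⟩ hβ, fun v w h => ?_⟩
  rw [hβe, kempeSwap_apply]
  by_cases hv : v ∈ D.supp
  · simp [hv, hDC hv]
  · simp [hv]

/-- Swaps on closed sets in a graph containing `G` restrict to Kempe changes in `G`. -/
theorem exists_kempeReachable_of_reach {W : Type*} [Finite V] {R : W → W → Prop}
    {φ ψ : W → W → K} (h : LoopedColoring.Reach R φ ψ) (ι : V → W)
    (hι : ∀ v w, G.Adj v w → R (ι v) (ι w)) (α : G.EdgeColoring K)
    (hα : ∀ v w (h : G.Adj v w), α ⟨s(v, w), h⟩ = φ (ι v) (ι w)) :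
    ∃ β : G.EdgeColoring K, α.KempeReachable β ∧
      ∀ v w (h : G.Adj v w), β ⟨s(v, w), h⟩ = ψ (ι v) (ι w) := by
  classical
  induction h with
  | refl => exact ⟨α, .refl, hα⟩
  | tail _ h ih =>
    obtain ⟨β, hβ, hβe⟩ := ih
    obtain ⟨a, b, C, hC, h⟩ := h
    -- A Kempe change needs distinct colours; with equal ones the swap does nothing.
    by_cases hab : a = b
    · refine ⟨β, hβ, fun v w hvw => ?_⟩
      rw [hβe, h _ _ (hι v w hvw), LoopedColoring.swapOn]
      grind
    · obtain ⟨γ, hγ, hγe⟩ := β.exists_kempeReachable_swap hab (ι ⁻¹' C) fun v w hvw hc hv =>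
        hC (hι v w hvw) (by rwa [← hβe v w hvw]) hv
      refine ⟨γ, hβ.trans hγ, fun v w hvw => ?_⟩
      rw [hγe, h _ _ (hι v w hvw), LoopedColoring.swapOn, hβe, Equiv.swap_apply_def]
      simp only [Set.mem_preimage]

/-- At each vertex, a permutation of the colours carries one colouring to another. -/
theorem exists_perm [Finite K] (α γ : G.EdgeColoring K) (v : V) :
    ∃ σ : Equiv.Perm K, ∀ w (h : G.Adj v w), σ (γ ⟨s(v, w), h⟩) = α ⟨s(v, w), h⟩ := by
  classical
  have := Fintype.ofFinite K
  have hinj : ∀ β : G.EdgeColoring K,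
      Function.Injective fun w : G.neighborSet v => β ⟨s(v, w), w.2⟩ := by
    intro β w w' he
    by_contra hne
    refine β.valid (lineGraph_adj_iff_exists.2 ⟨fun h' => hne ?_, v, ?_, ?_⟩) he
    · exact Subtype.ext (Sym2.congr_right.1 (congrArg Subtype.val h'))
    · exact Sym2.mem_mk_left _ _
    · exact Sym2.mem_mk_left _ _
  let e := (Equiv.ofInjective _ (hinj γ)).symm.trans (Equiv.ofInjective _ (hinj α))
  refine ⟨Equiv.extendSubtype e, fun w h => ?_⟩
  rw [Equiv.extendSubtype_apply_of_mem e _ ⟨⟨w, h⟩, rfl⟩]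
  have : (⟨γ ⟨s(v, w), h⟩, ⟨⟨w, h⟩, rfl⟩⟩ : Set.range fun w : G.neighborSet v => γ ⟨s(v, w), w.2⟩) =
    Equiv.ofInjective _ (hinj γ) ⟨w, h⟩ := rfl
  simp only [e, Equiv.trans_apply]
  erw [this, Equiv.symm_apply_apply]
  rfl

/-! ### The cube extension -/

/-- The neighbour of `x` in direction `c` in a cube graph in which the direction `o` is
degenerate. -/
def flip [DecidableEq K] (o c : K) (x : K → Bool) : K → Bool :=
  if c = o then x else Function.update x c (!x c)

theorem flip_flip [DecidableEq K] (o c : K) (x : K → Bool) : flip o c (flip o c x) = x := by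
  unfold flip
  split_ifs <;> simp

theorem flip_apply [DecidableEq K] (o c d : K) (x : K → Bool) :
    flip o c x d = if c ≠ o ∧ d = c then !x d else x d := by
  unfold flip
  by_cases hc : c = o <;> by_cases hd : d = c <;> simp [hc, hd]

theorem flip_left_injective [DecidableEq K] {o c d : K} {x : K → Bool}
    (h : flip o c x = flip o d x) : c = d := by
  have h1 := congrFun h c
  have h2 := congrFun h d
  simp only [flip_apply] at h1 h2
  grind

/-- Two vertices of `V × (K → Bool)` are joined in colour `c` if they are copies of the ends of an
edge of `G` of colour `c`, or copies of a vertex at which `c` is missing and neighbours in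
direction `c` in the cube. -/
def CubeRel [DecidableEq K] (γ : G.EdgeColoring K) (o c : K) (p q : V × (K → Bool)) : Prop :=
  (∃ h : G.Adj p.1 q.1, γ ⟨s(p.1, q.1), h⟩ = c ∧ p.2 = q.2) ∨
    p.1 = q.1 ∧ (∀ w (h : G.Adj p.1 w), γ ⟨s(p.1, w), h⟩ ≠ c) ∧ q.2 = flip o c p.2

section

variable [DecidableEq K] {γ : G.EdgeColoring K} {o c d : K} {p q r : V × (K → Bool)}

theorem CubeRel.symm (h : CubeRel γ o c p q) : CubeRel γ o c q p := by
  obtain ⟨v, x⟩ := p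
  obtain ⟨w, y⟩ := q
  rcases h with ⟨h, hc, hx⟩ | ⟨h, hm, hx⟩
  · refine .inl ⟨h.symm, ?_, hx.symm⟩
    rw [← hc]
    congr 2
    exact Sym2.eq_swap
  · dsimp at h hm hx
    subst h
    exact .inr ⟨rfl, hm, by simp [hx, flip_flip]⟩

theorem CubeRel.color_unique (h : CubeRel γ o c p q) (h' : CubeRel γ o d p q) : c = d := by
  rcases h with ⟨h, hc, hx⟩ | ⟨h, hm, hx⟩ <;> rcases h' with ⟨h', hc', hx'⟩ | ⟨h', hm', hx'⟩
  · exact hc.symm.trans hc'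
  · exact absurd h' h.ne
  · exact absurd h h'.ne
  · exact flip_left_injective (hx.symm.trans hx')

theorem CubeRel.unique (h : CubeRel γ o c p q) (h' : CubeRel γ o c p r) : q = r := by
  obtain ⟨v, x⟩ := p
  obtain ⟨w, y⟩ := q
  obtain ⟨w', y'⟩ := r
  rcases h with ⟨h, hc, hx⟩ | ⟨h, hm, hx⟩ <;> rcases h' with ⟨h', hc', hx'⟩ | ⟨h', hm', hx'⟩ <;>
    dsimp at *
  · refine Prod.ext ?_ (hx.symm.trans hx')
    by_contra hne
    refine γ.valid (v := ⟨s(v, w), h⟩) (w := ⟨s(v, w'), h'⟩) (lineGraph_adj_iff_exists.2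
      ⟨fun he => hne (Sym2.congr_right.1 (congrArg Subtype.val he)), v, ?_, ?_⟩) (hc.trans hc'.symm)
    · exact Sym2.mem_mk_left _ _
    · exact Sym2.mem_mk_left _ _
  · exact absurd hc (hm' w h)
  · exact absurd hc' (hm w' h')
  · exact Prod.ext (h.symm.trans h') (hx.trans hx'.symm)

theorem exists_cubeRel (γ : G.EdgeColoring K) (o c : K) (p : V × (K → Bool)) :
    ∃ q, CubeRel γ o c p q := by
  by_cases h : ∃ w, ∃ h : G.Adj p.1 w, γ ⟨s(p.1, w), h⟩ = c
  · obtain ⟨w, h, hc⟩ := h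
    exact ⟨(w, p.2), .inl ⟨h, hc, rfl⟩⟩
  · push Not at h
    exact ⟨(p.1, flip o c p.2), .inr ⟨rfl, h, rfl⟩⟩

/-- Projected to `G`, a triangle would be a triangle or have exactly one or two degenerate sides,
unless it lies in the cube over one vertex; the mixed cases collapse or are absurd. -/
theorem triangleFree_cubeRel (hG : G.CliqueFree 3) :
    LoopedColoring.TriangleFree fun p q => ∃ c, CubeRel γ o c p q := by
  rintro ⟨u, x⟩ ⟨v, y⟩ ⟨w, z⟩ ⟨c, h1⟩ ⟨d, h2⟩ ⟨e, h3⟩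
  rcases h1 with ⟨h1, -, hx1⟩ | ⟨h1, -, hx1⟩ <;> rcases h2 with ⟨h2, -, hx2⟩ | ⟨h2, -, hx2⟩ <;>
    rcases h3 with ⟨h3, -, hx3⟩ | ⟨h3, -, hx3⟩ <;> dsimp at *
  · classical
    exact absurd (is3Clique_triple_iff.2 ⟨h1, h3, h2⟩) (hG {u, v, w})
  · exact .inr (.inr (Prod.ext h3 (hx1.trans hx2)))
  · exact .inr (.inl (Prod.ext h2 (hx1.symm.trans hx3)))
  · exact absurd (h3.trans h2.symm) h1.ne
  · exact .inl (Prod.ext h1 (hx3.trans hx2.symm))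
  · exact absurd (h1.symm.trans h3) h2.ne
  · exact absurd (h1.trans h2) h3.ne
  · subst h1 h2
    have e1 := congrFun hx1
    have e2 := congrFun hx2
    have e3 := congrFun hx3
    simp only [flip_apply] at e1 e2 e3
    by_cases hc : c = o
    · exact .inl (by rw [hx1, flip, if_pos hc])
    by_cases hd : d = o
    · exact .inr (.inl (by rw [hx2, flip, if_pos hd]))
    by_cases he : e = o
    · exact .inr (.inr (by rw [hx3, flip, if_pos he]))
    -- Two genuine flips cannot amount to a single one, as the coordinates `c`, `d` and `e` show.
    exfalso
    have := e1 c
    have := e1 d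
    have := e1 e
    have := e2 c
    have := e2 d
    have := e2 e
    have := e3 c
    have := e3 d
    have := e3 e
    grind

open Classical in
/-- The colouring of the graph on `V × (K → Bool)` given by `CubeRel`. -/
noncomputable def cubeColor (γ : G.EdgeColoring K) (o : K) (p q : V × (K → Bool)) : K :=
  if h : ∃ c, CubeRel γ o c p q then h.choose else o

theorem cubeColor_eq (h : CubeRel γ o c p q) : cubeColor γ o p q = c := by
  have h' : ∃ c, CubeRel γ o c p q := ⟨c, h⟩
  rw [cubeColor, dif_pos h']
  exact h'.choose_spec.color_unique h

theorem isColoring_cubeColor (ho : o ∉ Set.range γ) :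
    LoopedColoring.IsColoring (fun p q => ∃ c, CubeRel γ o c p q) (cubeColor γ o) := by
  refine ⟨fun p => ⟨o, .inr ⟨rfl, fun w h he => ho ⟨_, he⟩, by simp [flip]⟩⟩, ?_, ?_, ?_, ?_⟩
  · rintro p q ⟨c, h⟩
    exact ⟨c, h.symm⟩
  · rintro p q ⟨c, h⟩
    rw [cubeColor_eq h, cubeColor_eq h.symm]
  · rintro p q r ⟨c, h⟩ ⟨d, h'⟩ he
    rw [cubeColor_eq h, cubeColor_eq h'] at he
    subst he
    exact h.unique h'
  · intro p c
    obtain ⟨q, h⟩ := exists_cubeRel γ o c p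
    exact ⟨q, ⟨c, h⟩, cubeColor_eq h⟩

/-- Symmetry is the point: along an edge of `G` both permutations give the colour under `α`, and a
cube edge joins copies of one vertex, where the permutation is the same. -/
theorem isColoring_perm_cubeColor (ho : o ∉ Set.range γ) {α : G.EdgeColoring K}
    {σ : V → Equiv.Perm K}
    (hσ : ∀ v w (h : G.Adj v w), σ v (γ ⟨s(v, w), h⟩) = α ⟨s(v, w), h⟩) :
    LoopedColoring.IsColoring (fun p q => ∃ c, CubeRel γ o c p q)
      fun p q => σ p.1 (cubeColor γ o p q) := by
  have hγ := isColoring_cubeColor (o := o) ho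
  refine ⟨hγ.refl, hγ.rel_symm, ?_, fun h h' he => hγ.inj h h' ((σ _).injective he), ?_⟩
  · rintro ⟨v, x⟩ ⟨w, y⟩ ⟨c, h⟩
    dsimp
    rw [cubeColor_eq h, cubeColor_eq h.symm]
    rcases h with ⟨h, hc, -⟩ | ⟨h, -⟩
    · have hs : (⟨s(w, v), h.symm⟩ : G.edgeSet) = ⟨s(v, w), h⟩ := Subtype.ext Sym2.eq_swap
      have h1 := hσ v w h
      have h2 := hσ w v h.symm
      dsimp at hc
      rw [hs, hc] at h2
      rw [hc] at h1
      rw [h1, h2]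
    · dsimp at h
      rw [h]
  · intro p c
    obtain ⟨q, hq, hc⟩ := hγ.surj p ((σ p.1).symm c)
    exact ⟨q, hq, by rw [hc, Equiv.apply_symm_apply]⟩

end

/-- In a triangle-free graph, a colouring that does not use all colours can be reached from every
colouring. -/
theorem kempeReachable_of_notMem_range [Finite V] [Finite K] (hG : G.CliqueFree 3)
    (α γ : G.EdgeColoring K) {o : K} (ho : o ∉ Set.range γ) : α.KempeReachable γ := by
  classical
  choose σ hσ using α.exists_perm γ
  have hγ := isColoring_cubeColor (o := o) ho
  have hreach := LoopedColoring.reach_of_loops_eq (d := o) (triangleFree_cubeRel hG)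
    (isColoring_perm_cubeColor ho hσ) hγ
    fun p => cubeColor_eq (.inr ⟨rfl, fun w h he => ho ⟨_, he⟩, by simp [flip]⟩)
  -- Any fixed copy of `G` in the cube extension would do.
  let x : K → Bool := fun _ => false
  have hrel : ∀ v w (h : G.Adj v w), CubeRel γ o (γ ⟨s(v, w), h⟩) (v, x) (w, x) :=
    fun v w h => .inl ⟨h, rfl, rfl⟩
  obtain ⟨β, hβ, hβe⟩ := exists_kempeReachable_of_reach hreach (fun v => (v, x))
    (fun v w h => ⟨_, hrel v w h⟩) α fun v w h => by
      rw [cubeColor_eq (hrel v w h)]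
      exact (hσ v w h).symm
  have : β = γ := by
    ext ⟨e, he⟩
    induction e using Sym2.ind with
    | _ v w => rw [hβe v w he, cubeColor_eq (hrel v w he)]
  exact this ▸ hβ

end SimpleGraph.EdgeColoring

theorem theorem1p5 {V : Type*} [Finite V] (G : SimpleGraph V) (hG : G.CliqueFree 3)
    (k : ℕ) (hk : G.chromaticIndex < (k : ℕ∞))
    (α : G.EdgeColoring (Fin k))
    (γ : G.EdgeColoring (Fin k)) (hγ : (Set.range γ).encard ≤ G.chromaticIndex) :
    α.KempeReachable γ := by
  obtain ⟨o, ho⟩ : ∃ o, o ∉ Set.range γ := by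
    by_contra! h
    rw [Set.eq_univ_of_forall h, Set.encard_univ, ENat.card_eq_coe_fintype_card,
      Fintype.card_fin] at hγ
    exact absurd hk hγ.not_gt
  exact α.kempeReachable_of_notMem_range hG γ ho
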